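/- Let $n,m\ge 0$ and let $\eta=(\eta^{ij})$ be an invertible complex $n\times n$ matrix with inverse $(\eta_{ij})$ (no symmetry has to be assumed: if $\eta$ is not symmetric, the algebra below is zero). Let $\mathcal A=W(2n|n)$ be the Weyl–Clifford algebra, i.e. the unital associative $\mathbb C$-algebra generated by $x^i,\partial_i,\gamma^i$ ($1\le i\le n$) with relations $$x^ix^j=x^jx^i,\quad \partial_i\partial_j=\partial_j\partial_i,\quad \partial_ix^j-x^j\partial_i=\delta_i^j,\quad \gamma^ix^j=x^j\gamma^i,\quad \gamma^i\partial_j=\partial_j\gamma^i,\quad \gamma^i\gamma^j+\gamma^j\gamma^i=2\eta^{ij}.$$ With summation over repeated indices put $x_i=\eta_{ij}x^j$, $\partial^i=\eta^{ij}\partial_j$, and $$X=\tfrac{\sqrt{-1}}{\sqrt2}\gamma^i\partial_i,\quad Y=\tfrac{\sqrt{-1}}{\sqrt2}\gamma^ix_i,\quad H=-\tfrac12(\partial_ix^i+x^i\partial_i),\quad E=-\tfrac12\partial^i\partial_i,\quad \tilde F=x_kx^k,\quad \tilde Y=x_k\gamma^k .$$ Let $\mathcal A'$ be the localization of $\mathcal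 A$ at the multiplicative set generated by $\{H+k:k\in\mathbb Z\}$, let $I'=\mathcal A'X+\mathcal A'E$, let $N(I')=\{a\in\mathcal A': I'a\subseteq I'\}$, and let $Z_n'=N(I')/I'\subseteq\mathcal A'/I'$. For $v\in\mathcal A'/I'$ put $$P(v)=\sum_{k\ge0}\varphi_k(H)Y^kX^kv,\qquad \varphi_k(H)=\prod_{j=1}^k\frac{(-1)^j}{\kappa_j(H)},\qquad \kappa_j(H)=\begin{cases}-j/2,& j\text{ even}\\ H+\frac{j+1}2,& j\text{ odd;}\end{cases}$$ the sum is finite for each $v$, and $P(v)\in Z_n'$. Let $\widehat{x^i}=(H+1)P(x^i+I')\in Z_n'$. Fix $i_1,\dots,i_m\in\{1,\dots,n\}$. For integers $a,r,s,t\ge0$ with $2a+r+s+t=m$ and a permutation $\alpha=(\alpha_1,\dots,\alpha_m)$ of $(1,\dots,m)$, let $(\eta^ax^r\gamma^s\partial^t)^{i_\alpha}$ be the product, in this order, of $\eta^{i_{\alpha_1}i_{\alpha_2}}\cdots\eta^{i_{\alpha_{2a-1}}i_{\alpha_{2a}}}$, of $x^{i_{\alpha_{j}}}$ for the next $r$ indices,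 of $\gamma^{i_{\alpha_j}}$ for the next $s$ indices, and of $\partial^{i_{\alpha_j}}$ for the last $t$ indices. It depends only on the class $[\alpha]$ of $\alpha$ under interchanging the two indices of an $\eta$, permuting the $\eta$'s, permuting the $x$'s, and permuting the $\partial$'s. Let $$[\eta^ax^r\gamma^s\partial^t]=\sum_{[\alpha]}(\eta^ax^r\gamma^s\partial^t)^{i_\alpha},$$ the sum being over these classes, and let the bracket be $0$ when $r<0$. Put $$S_q^0=\sum_{t=0}^{q}[\eta^tx^{m-q-t}\partial^{q-t}],\qquad S_q^1=\sum_{t=0}^{q-1}[\eta^tx^{m-q-t}\gamma\,\partial^{q-1-t}].$$ **Theorem.** In $Z_n'\subseteq\mathcal A'/I'$, $$\widehat{x^{i_1}}\cdots\widehat{x^{i_m}}=(H+1)\cdots(H+m)\,x^{i_1}\cdots x^{i_m}+\sum_{q=1}^m\frac{\prod_{k=q+1}^m(H+k)}{2^q}\,\tilde F^{\,q-1}\bigl(\tilde Y S_q^1+\tilde F S_q^0\bigr)+I'.$$ -/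

import Mathlib

namespace DiracReduction

open OreLocalization

/-- The generators `x^i`, `∂_i`, `γ^i` of the Weyl-Clifford algebra of rank `n`. -/
inductive Gen (n : ℕ) : Type
  | x (i : Fin n) : Gen n
  | d (i : Fin n) : Gen n
  | g (i : Fin n) : Gen n

/-- The defining relations of the Weyl-Clifford algebra; `η i j` is `η^{ij}`. -/
inductive Rel {n : ℕ} (η : GL (Fin n) ℂ) :
    FreeAlgebra ℂ (Gen n) → FreeAlgebra ℂ (Gen n) → Prop
  | xx (i j : Fin n) : Rel η
      (FreeAlgebra.ι ℂ (Gen.x i) * FreeAlgebra.ι ℂ (Gen.x j))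
      (FreeAlgebra.ι ℂ (Gen.x j) * FreeAlgebra.ι ℂ (Gen.x i))
  | dd (i j : Fin n) : Rel η
      (FreeAlgebra.ι ℂ (Gen.d i) * FreeAlgebra.ι ℂ (Gen.d j))
      (FreeAlgebra.ι ℂ (Gen.d j) * FreeAlgebra.ι ℂ (Gen.d i))
  | dx (i j : Fin n) : Rel η
      (FreeAlgebra.ι ℂ (Gen.d i) * FreeAlgebra.ι ℂ (Gen.x j))
      (FreeAlgebra.ι ℂ (Gen.x j) * FreeAlgebra.ι ℂ (Gen.d i) + (if i = j then 1 else 0))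
  | gx (i j : Fin n) : Rel η
      (FreeAlgebra.ι ℂ (Gen.g i) * FreeAlgebra.ι ℂ (Gen.x j))
      (FreeAlgebra.ι ℂ (Gen.x j) * FreeAlgebra.ι ℂ (Gen.g i))
  | gd (i j : Fin n) : Rel η
      (FreeAlgebra.ι ℂ (Gen.g i) * FreeAlgebra.ι ℂ (Gen.d j))
      (FreeAlgebra.ι ℂ (Gen.d j) * FreeAlgebra.ι ℂ (Gen.g i))
  | gg (i j : Fin n) : Rel η
      (FreeAlgebra.ι ℂ (Gen.g i) * FreeAlgebra.ι ℂ (Gen.g j)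
        + FreeAlgebra.ι ℂ (Gen.g j) * FreeAlgebra.ι ℂ (Gen.g i))
      (algebraMap ℂ (FreeAlgebra ℂ (Gen n)) (2 * η.val i j))

/-- The Weyl-Clifford algebra `W(2n|n)`. -/
def WC {n : ℕ} (η : GL (Fin n) ℂ) : Type := RingQuot (Rel η)

noncomputable instance {n : ℕ} (η : GL (Fin n) ℂ) : Ring (WC η) :=
  inferInstanceAs (Ring (RingQuot (Rel η)))

noncomputable instance {n : ℕ} (η : GL (Fin n) ℂ) : Algebra ℂ (WC η) :=
  inferInstanceAs (Algebra ℂ (RingQuot (Rel η)))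

section WeylClifford

variable {n : ℕ} (η : GL (Fin n) ℂ)

/-- The quotient map from the free algebra. -/
noncomputable def quot : FreeAlgebra ℂ (Gen n) →ₐ[ℂ] WC η := RingQuot.mkAlgHom ℂ (Rel η)

/-- The generator `x^i`. -/
noncomputable def x (i : Fin n) : WC η := quot η (FreeAlgebra.ι ℂ (Gen.x i))

/-- The generator `∂_i`. -/
noncomputable def d (i : Fin n) : WC η := quot η (FreeAlgebra.ι ℂ (Gen.d i))

/-- The generator `γ^i`. -/
noncomputable def g (i : Fin n) : WC η := quot η (FreeAlgebra.ι ℂ (Gen.g i))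

/-- `x_i = η_{ij} x^j`, where `(η_{ij})` is the inverse matrix of `(η^{ij})`. -/
noncomputable def xLow (i : Fin n) : WC η := ∑ j, (η⁻¹).val i j • x η j

/-- `∂^i = η^{ij} ∂_j`. -/
noncomputable def dUp (i : Fin n) : WC η := ∑ j, η.val i j • d η j

/-- `H = -(1/2) (∂_i x^i + x^i ∂_i)`. -/
noncomputable def H : WC η := (-(1 / 2) : ℂ) • ∑ i, (d η i * x η i + x η i * d η i)

/-- `X = (i/√2) γ^i ∂_i`. -/
noncomputable def X : WC η := (Complex.I / (Real.sqrt 2 : ℂ)) • ∑ i, g η i * d η i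

/-- `Y = (i/√2) γ^i x_i`. -/
noncomputable def Y : WC η := (Complex.I / (Real.sqrt 2 : ℂ)) • ∑ i, g η i * xLow η i

/-- `E = -(1/2) ∂^i ∂_i`. -/
noncomputable def E : WC η := (-(1 / 2) : ℂ) • ∑ i, dUp η i * d η i

/-- The multiplicative set generated by the elements `H + k`, `k ∈ ℤ`. -/
noncomputable def D : Submonoid (WC η) :=
  Submonoid.closure (Set.range fun k : ℤ => H η + (k : WC η))

theorem quot_rel {a b : FreeAlgebra ℂ (Gen n)} (h : Rel η a b) : quot η a = quot η b :=
  RingQuot.mkAlgHom_rel ℂ h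

theorem x_mul_x (i j : Fin n) : x η i * x η j = x η j * x η i := by
  simpa [x] using quot_rel η (Rel.xx i j)

theorem d_mul_d (i j : Fin n) : d η i * d η j = d η j * d η i := by
  simpa [d] using quot_rel η (Rel.dd i j)

theorem d_mul_x (i j : Fin n) :
    d η i * x η j = x η j * d η i + (if i = j then 1 else 0) := by
  have h := quot_rel η (Rel.dx i j)
  rw [map_add, map_mul, map_mul, apply_ite (quot η), map_one, map_zero] at h
  exact h

theorem g_mul_x (i j : Fin n) : g η i * x η j = x η j * g η i := by
  simpa [x, g] using quot_rel η (Rel.gx i j)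

theorem g_mul_d (i j : Fin n) : g η i * d η j = d η j * g η i := by
  simpa [d, g] using quot_rel η (Rel.gd i j)

theorem g_mul_g (i j : Fin n) :
    g η i * g η j + g η j * g η i = algebraMap ℂ (WC η) (2 * η.val i j) := by
  have h := quot_rel η (Rel.gg i j)
  rw [map_add, map_mul, map_mul, AlgHom.commutes] at h
  exact h

/-- Induction on the elements of the Weyl-Clifford algebra. -/
theorem WC.ind {p : WC η → Prop} (hc : ∀ c : ℂ, p (algebraMap ℂ (WC η) c))
    (hx : ∀ i, p (x η i)) (hd : ∀ i, p (d η i)) (hg : ∀ i, p (g η i))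
    (hmul : ∀ a b, p a → p b → p (a * b)) (hadd : ∀ a b, p a → p b → p (a + b))
    (a : WC η) : p a := by
  obtain ⟨b, rfl⟩ : ∃ b, quot η b = a := RingQuot.mkAlgHom_surjective ℂ (Rel η) a
  induction b using FreeAlgebra.induction with
  | grade0 r => rw [AlgHom.commutes]; exact hc r
  | grade1 y => cases y with
    | x i => exact hx i
    | d i => exact hd i
    | g i => exact hg i
  | mul a b ha hb => rw [map_mul]; exact hmul _ _ ha hb
  | add a b ha hb => rw [map_add]; exact hadd _ _ ha hb

theorem x_mul_H (i : Fin n) : x η i * H η = (H η + ((1 : ℤ) : WC η)) * x η i := by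
  have h : ∀ j, x η i * (d η j * x η j + x η j * d η j)
      = (d η j * x η j + x η j * d η j) * x η i - (if j = i then (2 : ℂ) • x η i else 0) := by
    intro j
    have h1 := d_mul_x η j i
    have h2 := x_mul_x η i j
    have h3 : x η i * d η j = d η j * x η i - (if j = i then 1 else 0) := by rw [h1]; abel
    rw [mul_add, ← mul_assoc, ← mul_assoc, h3, h2, mul_assoc, h3]
    split_ifs with hji
    · subst hji
      rw [two_smul]; noncomm_ring
    · simp only [sub_zero, add_mul, mul_assoc, h2]
  unfold H
  rw [mul_smul_comm, Finset.mul_sum, Finset.sum_congr rfl (fun j _ => h j),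
    Finset.sum_sub_distrib, Finset.sum_ite_eq' Finset.univ i, if_pos (Finset.mem_univ i),
    ← Finset.sum_mul, smul_sub, smul_smul, add_mul, smul_mul_assoc]
  norm_num

theorem d_mul_H (i : Fin n) : d η i * H η = (H η + ((-1 : ℤ) : WC η)) * d η i := by
  have h : ∀ j, d η i * (d η j * x η j + x η j * d η j)
      = (d η j * x η j + x η j * d η j) * d η i + (if i = j then (2 : ℂ) • d η i else 0) := by
    intro j
    have h1 := d_mul_x η i j
    have h2 := d_mul_d η i j
    rw [mul_add, ← mul_assoc, ← mul_assoc, h1, h2, mul_assoc, h1]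
    split_ifs with hij
    · subst hij
      rw [two_smul]; noncomm_ring
    · simp only [add_zero, add_mul, mul_assoc, h2]
  unfold H
  rw [mul_smul_comm, Finset.mul_sum, Finset.sum_congr rfl (fun j _ => h j),
    Finset.sum_add_distrib, Finset.sum_ite_eq Finset.univ i, if_pos (Finset.mem_univ i),
    ← Finset.sum_mul, smul_add, smul_smul, add_mul, smul_mul_assoc]
  norm_num

theorem g_mul_H (i : Fin n) : g η i * H η = (H η + ((0 : ℤ) : WC η)) * g η i := by
  have h : ∀ j, g η i * (d η j * x η j + x η j * d η j)
      = (d η j * x η j + x η j * d η j) * g η i := by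
    intro j
    have h1 := g_mul_x η i j
    have h2 := g_mul_d η i j
    rw [mul_add, ← mul_assoc, ← mul_assoc, h1, h2, mul_assoc, h1, mul_assoc, h2, add_mul,
      mul_assoc, mul_assoc]
  unfold H
  rw [mul_smul_comm, Finset.mul_sum, Finset.sum_congr rfl (fun j _ => h j),
    ← Finset.sum_mul, Int.cast_zero, add_zero, smul_mul_assoc]

theorem mem_D (k : ℤ) : H η + (k : WC η) ∈ D η :=
  Submonoid.subset_closure ⟨k, rfl⟩

theorem D_comm {s t : WC η} (hs : s ∈ D η) (ht : t ∈ D η) : s * t = t * s := by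
  have h1 : ∀ t ∈ D η, Commute (H η) t := by
    intro t ht
    refine Submonoid.closure_induction ?_ (Commute.one_right _) (fun _ _ _ _ => Commute.mul_right) ht
    rintro _ ⟨k, rfl⟩
    exact (Commute.refl _).add_right (Int.cast_commute k _).symm
  refine Submonoid.closure_induction (motive := fun s _ => Commute s t) ?_ (Commute.one_left _)
    (fun _ _ _ _ => Commute.mul_left) hs
  rintro _ ⟨k, rfl⟩
  exact (h1 t ht).add_left (Int.cast_commute k _)

theorem shift_D {a : WC η} {w : ℤ} (ha : a * H η = (H η + (w : WC η)) * a) {s : WC η}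
    (hs : s ∈ D η) : ∃ s' ∈ D η, s' * a = a * s := by
  refine Submonoid.closure_induction (motive := fun s _ => ∃ s' ∈ D η, s' * a = a * s) ?_
    ⟨1, one_mem _, by simp⟩ ?_ hs
  · rintro _ ⟨k, rfl⟩
    refine ⟨H η + ((w + k : ℤ) : WC η), mem_D η _, ?_⟩
    rw [mul_add, ha, Int.cast_add, ← add_assoc, add_mul _ (k : WC η),
      (Int.cast_commute k a).eq]
  · rintro s t _ _ ⟨s', hs', h1⟩ ⟨t', ht', h2⟩
    exact ⟨s' * t', mul_mem hs' ht', by rw [mul_assoc, h2, ← mul_assoc, h1, mul_assoc]⟩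

theorem shift_D' {a : WC η} {w : ℤ} (ha : a * H η = (H η + (w : WC η)) * a) {s : WC η}
    (hs : s ∈ D η) : ∃ s' ∈ D η, s * a = a * s' := by
  refine Submonoid.closure_induction (motive := fun s _ => ∃ s' ∈ D η, s * a = a * s') ?_
    ⟨1, one_mem _, by simp⟩ ?_ hs
  · rintro _ ⟨k, rfl⟩
    refine ⟨H η + ((k - w : ℤ) : WC η), mem_D η _, ?_⟩
    rw [mul_add, ha, ← (Int.cast_commute (k - w) a).eq, ← add_mul, add_assoc, ← Int.cast_add]
    congr 3
    ring
  · rintro s t _ _ ⟨s', hs', h1⟩ ⟨t', ht', h2⟩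
    exact ⟨s' * t', mul_mem hs' ht', by rw [mul_assoc, h2, ← mul_assoc, h1, mul_assoc]⟩

theorem D_ore (r : WC η) : ∀ s ∈ D η, ∃ r', ∃ s' ∈ D η, s' * r = r' * s := by
  have key : ∀ (a : WC η) (w : ℤ), a * H η = (H η + (w : WC η)) * a →
      ∀ s ∈ D η, ∃ r', ∃ s' ∈ D η, s' * a = r' * s := fun a w ha s hs => by
    obtain ⟨s', hs', h⟩ := shift_D η ha hs
    exact ⟨a, s', hs', h⟩
  induction r using WC.ind η with
  | hc c => exact fun s hs => ⟨algebraMap ℂ _ c, s, hs, (Algebra.commutes c s).symm⟩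
  | hx i => exact key _ _ (x_mul_H η i)
  | hd i => exact key _ _ (d_mul_H η i)
  | hg i => exact key _ _ (g_mul_H η i)
  | hmul a b ha hb =>
    intro s hs
    obtain ⟨b', s1, hs1, h1⟩ := hb s hs
    obtain ⟨a', s2, hs2, h2⟩ := ha s1 hs1
    exact ⟨a' * b', s2, hs2, by rw [← mul_assoc, h2, mul_assoc, h1, mul_assoc]⟩
  | hadd a b ha hb =>
    intro s hs
    obtain ⟨a', s1, hs1, h1⟩ := ha s hs
    obtain ⟨b', s2, hs2, h2⟩ := hb s hs
    refine ⟨s2 * a' + s1 * b', s1 * s2, mul_mem hs1 hs2, ?_⟩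
    rw [mul_add, D_comm η hs1 hs2, mul_assoc, h1, ← D_comm η hs1 hs2, mul_assoc, h2, add_mul,
      mul_assoc, mul_assoc]

/-- Every element is a sum of eigenvectors of `ad H` with integer eigenvalues. -/
theorem mem_span_weight (r : WC η) :
    r ∈ AddSubmonoid.closure {a : WC η | ∃ w : ℤ, a * H η = (H η + (w : WC η)) * a} := by
  induction r using WC.ind η with
  | hc c =>
    refine AddSubmonoid.subset_closure ⟨0, ?_⟩
    rw [Int.cast_zero, add_zero, Algebra.commutes]
  | hx i => exact AddSubmonoid.subset_closure ⟨_, x_mul_H η i⟩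
  | hd i => exact AddSubmonoid.subset_closure ⟨_, d_mul_H η i⟩
  | hg i => exact AddSubmonoid.subset_closure ⟨_, g_mul_H η i⟩
  | hmul a b ha hb =>
    refine AddSubmonoid.closure_induction₂
      (motive := fun a b _ _ => a * b ∈ AddSubmonoid.closure
        {a : WC η | ∃ w : ℤ, a * H η = (H η + (w : WC η)) * a}) ?_ ?_ ?_ ?_ ?_ ha hb
    · rintro a b ⟨v, hv⟩ ⟨w, hw⟩
      refine AddSubmonoid.subset_closure ⟨v + w, ?_⟩
      rw [mul_assoc, hw, ← mul_assoc, mul_add, hv, ← (Int.cast_commute w a).eq, ← add_mul,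
        add_assoc, ← Int.cast_add, mul_assoc]
    · intro b _; rw [zero_mul]; exact zero_mem _
    · intro b _; rw [mul_zero]; exact zero_mem _
    · intro a b c _ _ _ h1 h2; rw [add_mul]; exact add_mem h1 h2
    · intro a b c _ _ _ h1 h2; rw [mul_add]; exact add_mem h1 h2
  | hadd a b ha hb => exact add_mem ha hb

/-- The operator `b ↦ (H + w) b - b H`. -/
noncomputable def wOp (w : ℤ) : AddMonoid.End (WC η) :=
  AddMonoidHom.mulLeft (H η + (w : WC η)) - AddMonoidHom.mulRight (H η)

theorem wOp_apply (w : ℤ) (b : WC η) : wOp η w b = (H η + (w : WC η)) * b - b * H η := rfl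

theorem wOp_comm (v w : ℤ) : Commute (wOp η v) (wOp η w) := by
  refine AddMonoidHom.ext fun b => ?_
  change wOp η v (wOp η w b) = wOp η w (wOp η v b)
  have h := D_comm η (mem_D η v) (mem_D η w)
  simp only [wOp_apply, mul_sub, sub_mul, ← mul_assoc, h]
  abel

theorem wOp_closure_comm {p q : AddMonoid.End (WC η)}
    (hp : p ∈ Submonoid.closure (Set.range (wOp η)))
    (hq : q ∈ Submonoid.closure (Set.range (wOp η))) : Commute p q := by
  refine Submonoid.closure_induction (motive := fun p _ => Commute p q) ?_ (Commute.one_left _)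
    (fun _ _ _ _ => Commute.mul_left) hp
  rintro _ ⟨v, rfl⟩
  refine Submonoid.closure_induction (motive := fun q _ => Commute (wOp η v) q) ?_
    (Commute.one_right _) (fun _ _ _ _ => Commute.mul_right) hq
  rintro _ ⟨w, rfl⟩
  exact wOp_comm η v w

theorem wOp_kill (r : WC η) :
    ∃ q ∈ Submonoid.closure (Set.range (wOp η)), q r = 0 := by
  refine AddSubmonoid.closure_induction
    (motive := fun r _ => ∃ q ∈ Submonoid.closure (Set.range (wOp η)), q r = 0)
    ?_ ⟨1, one_mem _, rfl⟩ ?_ (mem_span_weight η r)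
  · rintro a ⟨w, hw⟩
    exact ⟨wOp η w, Submonoid.subset_closure ⟨w, rfl⟩, by rw [wOp_apply, hw, sub_self]⟩
  · rintro a b _ _ ⟨p, hp, h1⟩ ⟨q, hq, h2⟩
    refine ⟨p * q, mul_mem hp hq, ?_⟩
    rw [map_add]
    have h3 : (p * q) a = (q * p) a := by rw [(wOp_closure_comm η hp hq).eq]
    rw [h3]
    change q (p a) + p (q b) = 0
    rw [h1, h2, map_zero, map_zero, add_zero]

theorem wOp_act (k : ℤ) {q : AddMonoid.End (WC η)}
    (hq : q ∈ Submonoid.closure (Set.range (wOp η))) :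
    ∀ b : WC η, b * (H η + (k : WC η)) = 0 → ∃ s ∈ D η, q b = s * b := by
  refine Submonoid.closure_induction (motive := fun q _ =>
    ∀ b : WC η, b * (H η + (k : WC η)) = 0 → ∃ s ∈ D η, q b = s * b) ?_ ?_ ?_ hq
  · rintro _ ⟨w, rfl⟩ b hb
    refine ⟨H η + ((w + k : ℤ) : WC η), mem_D η _, ?_⟩
    rw [mul_add, ← (Int.cast_commute k b).eq] at hb
    rw [wOp_apply, eq_neg_of_add_eq_zero_left hb, Int.cast_add]
    noncomm_ring
  · intro b _
    exact ⟨1, one_mem _, (one_mul b).symm⟩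
  · intro p q _ _ h1 h2 b hb
    obtain ⟨s, hs, h3⟩ := h2 b hb
    obtain ⟨t, ht, h4⟩ := h1 (s * b) (by rw [mul_assoc, hb, mul_zero])
    refine ⟨t * s, mul_mem ht hs, ?_⟩
    change p (q b) = _
    rw [h3, h4, mul_assoc]

theorem D_cancel {s : WC η} (hs : s ∈ D η) :
    ∀ r : WC η, r * s = 0 → ∃ s' ∈ D η, s' * r = 0 := by
  refine Submonoid.closure_induction
    (motive := fun s _ => ∀ r : WC η, r * s = 0 → ∃ s' ∈ D η, s' * r = 0) ?_ ?_ ?_ hs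
  · rintro _ ⟨k, rfl⟩ r hr
    obtain ⟨q, hq, h⟩ := wOp_kill η r
    obtain ⟨s, hs, h'⟩ := wOp_act η k hq r hr
    exact ⟨s, hs, h'.symm.trans h⟩
  · intro r hr
    exact ⟨1, one_mem _, by simpa using hr⟩
  · intro s t _ _ h1 h2 r hr
    obtain ⟨t', ht', h3⟩ := h2 (r * s) (by rw [mul_assoc, hr])
    obtain ⟨s', hs', h4⟩ := h1 (t' * r) (by rw [mul_assoc, h3])
    exact ⟨s' * t', mul_mem hs' ht', by rw [mul_assoc, h4]⟩

/-- The set generated by the `H + k` satisfies the left Ore condition. -/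
noncomputable instance : OreSet (D η) :=
  Classical.choice <| nonempty_oreSet_iff.mpr ⟨fun r₁ r₂ s h => by
    obtain ⟨s', hs', h'⟩ := D_cancel η s.2 (r₁ - r₂) (by rw [sub_mul, h, sub_self])
    exact ⟨⟨s', hs'⟩, by rw [mul_sub] at h'; exact sub_eq_zero.mp h'⟩, fun r s => by
    obtain ⟨r', s', hs', h⟩ := D_ore η r s s.2
    exact ⟨r', ⟨s', hs'⟩, h⟩⟩

/-- The localization `A'` of the Weyl-Clifford algebra at `D`. -/
def LWC : Type := OreLocalization (D η) (WC η)

noncomputable instance : Ring (LWC η) := inferInstanceAs (Ring (OreLocalization (D η) (WC η)))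

noncomputable instance : Algebra ℂ (LWC η) :=
  inferInstanceAs (Algebra ℂ (OreLocalization (D η) (WC η)))

/-- The canonical map from the Weyl-Clifford algebra to its localization. -/
noncomputable def loc : WC η →ₐ[ℂ] LWC η :=
  { (numeratorRingHom : WC η →+* OreLocalization (D η) (WC η)) with
    commutes' := fun _ => rfl }

theorem isUnit_loc {s : WC η} (hs : s ∈ D η) : IsUnit (loc η s) :=
  OreLocalization.numerator_isUnit (⟨s, hs⟩ : D η)

theorem exists_loc (a : LWC η) : ∃ s ∈ D η, ∃ r : WC η, loc η s * a = loc η r := by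
  induction a using OreLocalization.ind with
  | _ r s => exact ⟨s, s.2, r, OreLocalization.mul_cancel⟩

/-! ### The commutation relations of `X`, `Y`, `H` -/

theorem c_sq : (Complex.I / (Real.sqrt 2 : ℂ)) * (Complex.I / (Real.sqrt 2 : ℂ)) = -(1 / 2) := by
  rw [div_mul_div_comm, Complex.I_mul_I, ← Complex.ofReal_mul,
    Real.mul_self_sqrt (by norm_num)]
  norm_num

theorem symm_or_subsingleton : (∀ i j, η.val i j = η.val j i) ∨ Subsingleton (WC η) := by
  by_cases h : ∀ i j, η.val i j = η.val j i
  · exact Or.inl h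
  · right
    push Not at h
    obtain ⟨i, j, hij⟩ := h
    have h1 : algebraMap ℂ (WC η) (2 * η.val i j) = algebraMap ℂ (WC η) (2 * η.val j i) := by
      rw [← g_mul_g, ← g_mul_g, add_comm]
    have h2 : algebraMap ℂ (WC η) (2 * η.val i j - 2 * η.val j i) = 0 := by
      rw [map_sub, h1, sub_self]
    have h3 : (2 * η.val i j - 2 * η.val j i) ≠ 0 := by
      intro h; apply hij; linear_combination h / 2
    have h4 : (1 : WC η) = 0 := by
      rw [← map_one (algebraMap ℂ (WC η)), ← mul_inv_cancel₀ h3, map_mul, h2, zero_mul]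
    exact subsingleton_of_zero_eq_one h4.symm

theorem xLow_mul_H (i : Fin n) : xLow η i * H η = (H η + ((1 : ℤ) : WC η)) * xLow η i := by
  simp only [xLow, Finset.sum_mul, Finset.mul_sum, smul_mul_assoc, mul_smul_comm, x_mul_H]

theorem X_mul_H : X η * H η = (H η + ((-1 : ℤ) : WC η)) * X η := by
  have h : ∀ i, g η i * d η i * H η = (H η + ((-1 : ℤ) : WC η)) * (g η i * d η i) := by
    intro i
    have h1 := g_mul_H η i
    rw [Int.cast_zero, add_zero] at h1
    rw [mul_assoc, d_mul_H, ← mul_assoc, mul_add, h1, ← (Int.cast_commute (-1) (g η i)).eq,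
      ← add_mul, mul_assoc]
  simp only [X, Finset.sum_mul, Finset.mul_sum, smul_mul_assoc, mul_smul_comm, h]

theorem Y_mul_H : Y η * H η = (H η + ((1 : ℤ) : WC η)) * Y η := by
  have h : ∀ i, g η i * xLow η i * H η = (H η + ((1 : ℤ) : WC η)) * (g η i * xLow η i) := by
    intro i
    have h1 := g_mul_H η i
    rw [Int.cast_zero, add_zero] at h1
    rw [mul_assoc, xLow_mul_H, ← mul_assoc, mul_add, h1, ← (Int.cast_commute 1 (g η i)).eq,
      ← add_mul, mul_assoc]
  simp only [Y, Finset.sum_mul, Finset.mul_sum, smul_mul_assoc, mul_smul_comm, h]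

theorem g_mul_xLow (i j : Fin n) : g η i * xLow η j = xLow η j * g η i := by
  simp only [xLow, Finset.sum_mul, Finset.mul_sum, smul_mul_assoc, mul_smul_comm, g_mul_x]

theorem d_mul_xLow (i j : Fin n) :
    d η i * xLow η j = xLow η j * d η i + algebraMap ℂ (WC η) ((η⁻¹).val j i) := by
  simp only [xLow, Finset.sum_mul, Finset.mul_sum, smul_mul_assoc, mul_smul_comm, d_mul_x,
    smul_add, Finset.sum_add_distrib, smul_ite, smul_zero, Finset.sum_ite_eq, Finset.mem_univ,
    if_true, Algebra.algebraMap_eq_smul_one]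

theorem sum_eta_xLow (i : Fin n) : ∑ j, η.val i j • xLow η j = x η i := by
  have h : ∀ k, ∑ j, η.val i j * (η⁻¹).val j k = if i = k then 1 else 0 := by
    intro k
    have h1 : η.val * (η⁻¹).val = 1 := by rw [← Units.val_mul, mul_inv_cancel]; rfl
    rw [← Matrix.mul_apply, h1, Matrix.one_apply]
  simp only [xLow, Finset.smul_sum, smul_smul]
  rw [Finset.sum_comm]
  simp only [← Finset.sum_smul, h, ite_smul, one_smul, zero_smul, Finset.sum_ite_eq,
    Finset.mem_univ, if_true]

theorem XY_add_YX : X η * Y η + Y η * X η = H η := by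
  rcases symm_or_subsingleton η with hs | hs
  swap
  · exact Subsingleton.elim _ _
  have h1 : η.val * (η⁻¹).val = 1 := by rw [← Units.val_mul, mul_inv_cancel]; rfl
  have hT : (η⁻¹).val.transpose = (η⁻¹).val := by
    have h2 : η.val.transpose = η.val := by ext i j; exact hs j i
    have h3 : (η⁻¹).val.transpose * η.val = 1 := by
      have h4 := congrArg Matrix.transpose h1
      rwa [Matrix.transpose_mul, h2, Matrix.transpose_one] at h4
    calc (η⁻¹).val.transpose = (η⁻¹).val.transpose * (η.val * (η⁻¹).val) := by rw [h1, mul_one]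
      _ = (η⁻¹).val := by rw [← mul_assoc, h3, one_mul]
  have hT' : ∀ i j, (η⁻¹).val j i = (η⁻¹).val i j := fun i j => congrFun (congrFun hT i) j
  have h4 : ∀ i, ∑ j, η.val i j * (η⁻¹).val j i = 1 := by
    intro i
    rw [← Matrix.mul_apply, h1, Matrix.one_apply_eq]
  -- the two parts of the anticommutator
  have hA : ∀ i j, g η i * d η i * (g η j * xLow η j) + g η j * xLow η j * (g η i * d η i)
      = (2 * η.val i j) • (xLow η j * d η i) + (η⁻¹).val j i • (g η i * g η j) := by
    intro i j
    have e1 : g η i * d η i * (g η j * xLow η j)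
        = g η i * g η j * (xLow η j * d η i) + (η⁻¹).val j i • (g η i * g η j) := by
      calc g η i * d η i * (g η j * xLow η j) = g η i * (d η i * g η j) * xLow η j := by
            simp only [mul_assoc]
        _ = g η i * g η j * (d η i * xLow η j) := by rw [← g_mul_d]; simp only [mul_assoc]
        _ = _ := by
            rw [d_mul_xLow, mul_add, ← Algebra.commutes, Algebra.smul_def]
    have e2 : g η j * xLow η j * (g η i * d η i) = g η j * g η i * (xLow η j * d η i) := by
      calc g η j * xLow η j * (g η i * d η i) = g η j * (xLow η j * g η i) * d η i := by
            simp only [mul_assoc]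
        _ = _ := by rw [← g_mul_xLow]; simp only [mul_assoc]
    rw [e1, e2, add_right_comm, ← add_mul, g_mul_g, ← Algebra.smul_def]
  have hB : ∑ i, ∑ j, (η⁻¹).val j i • (g η i * g η j) = (n : WC η) := by
    have h5 : ∑ i, ∑ j, (η⁻¹).val j i • (g η i * g η j)
        = ∑ i, ∑ j, (η⁻¹).val j i • (g η j * g η i) := by
      rw [Finset.sum_comm]
      refine Finset.sum_congr rfl fun i _ => Finset.sum_congr rfl fun j _ => ?_
      rw [hT']
    have h6 : (2 : ℂ) • ∑ i, ∑ j, (η⁻¹).val j i • (g η i * g η j) = (2 : ℂ) • (n : WC η) := by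
      conv_lhs => rw [two_smul]; arg 2; rw [h5]
      simp only [← Finset.sum_add_distrib, ← smul_add, g_mul_g,
        Algebra.algebraMap_eq_smul_one, smul_smul, ← Finset.sum_smul]
      have h7 : ∑ i, ∑ j, (η⁻¹).val j i * (2 * η.val i j) = 2 * (n : ℂ) := by
        have h8 : ∀ i, ∑ j, (η⁻¹).val j i * (2 * η.val i j) = 2 := by
          intro i
          trans 2 * ∑ j, η.val i j * (η⁻¹).val j i
          swap
          · rw [h4, mul_one]
          rw [Finset.mul_sum]
          exact Finset.sum_congr rfl fun j _ => by ring
        simp only [h8, Finset.sum_const, Finset.card_univ, Fintype.card_fin, nsmul_eq_mul]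
        ring
      rw [h7, mul_smul]
      congr 1
      rw [← Algebra.algebraMap_eq_smul_one, map_natCast]
    exact (smul_right_injective (WC η) (two_ne_zero (α := ℂ))) h6
  have hC : ∑ i, ∑ j, (2 * η.val i j) • (xLow η j * d η i) = ∑ i, (2 : ℂ) • (x η i * d η i) := by
    refine Finset.sum_congr rfl fun i _ => ?_
    rw [← sum_eta_xLow, Finset.sum_mul, Finset.smul_sum]
    refine Finset.sum_congr rfl fun j _ => ?_
    rw [smul_mul_assoc, smul_smul]
  have hD : H η = (-(1 / 2) : ℂ) • (∑ i, (2 : ℂ) • (x η i * d η i) + (n : WC η)) := by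
    unfold H
    congr 1
    have : ∀ i, d η i * x η i + x η i * d η i = (2 : ℂ) • (x η i * d η i) + 1 := by
      intro i
      rw [d_mul_x, if_pos rfl, two_smul]; abel
    simp [this, Finset.sum_add_distrib]
  rw [hD, ← hB, ← hC, ← Finset.sum_add_distrib]
  simp only [← Finset.sum_add_distrib, ← hA]
  simp only [X, Y, smul_mul_smul_comm, c_sq, ← smul_add, Finset.sum_add_distrib]
  rw [Finset.sum_mul_sum, Finset.sum_mul_sum]
  congr 2
  exact Finset.sum_comm

theorem X_mul_x (i : Fin n) :
    X η * x η i = x η i * X η + (Complex.I / (Real.sqrt 2 : ℂ)) • g η i := by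
  have h : ∀ j, g η j * d η j * x η i = x η i * (g η j * d η j) + if j = i then g η j else 0 := by
    intro j
    rw [mul_assoc, d_mul_x, mul_add, ← mul_assoc, g_mul_x, mul_ite, mul_one, mul_zero, mul_assoc]
  simp only [X, smul_mul_assoc, mul_smul_comm, Finset.sum_mul, Finset.mul_sum, h,
    Finset.sum_add_distrib, Finset.sum_ite_eq', Finset.mem_univ, if_true, smul_add]

theorem X_mul_d (i : Fin n) : X η * d η i = d η i * X η := by
  have h : ∀ j, g η j * d η j * d η i = d η i * (g η j * d η j) := by
    intro j
    rw [mul_assoc, d_mul_d, ← mul_assoc, g_mul_d, mul_assoc]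
  simp only [X, smul_mul_assoc, mul_smul_comm, Finset.sum_mul, Finset.mul_sum, h]

theorem X_mul_g (i : Fin n) :
    X η * g η i + g η i * X η
      = (Complex.I / (Real.sqrt 2 : ℂ)) • ∑ j, (2 * η.val j i) • d η j := by
  have h : ∀ j, g η j * d η j * g η i + g η i * (g η j * d η j) = (2 * η.val j i) • d η j := by
    intro j
    rw [mul_assoc, ← g_mul_d, ← mul_assoc, ← mul_assoc, ← add_mul, g_mul_g, Algebra.smul_def]
  simp only [X, smul_mul_assoc, mul_smul_comm, Finset.sum_mul, Finset.mul_sum, ← smul_add,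
    ← Finset.sum_add_distrib, h]

theorem X_sq : X η * X η = E η := by
  have h : ∑ i, ∑ j, g η i * d η i * (g η j * d η j) = ∑ i, dUp η i * d η i := by
    have h1 : ∀ i j, g η i * d η i * (g η j * d η j) = g η i * g η j * (d η i * d η j) := by
      intro i j
      rw [mul_assoc, ← mul_assoc (d η i), ← g_mul_d]; simp only [mul_assoc]
    have h2 : (2 : ℂ) • ∑ i, ∑ j, g η i * d η i * (g η j * d η j)
        = (2 : ℂ) • ∑ i, dUp η i * d η i := by
      rw [two_smul]
      conv_lhs => arg 2; rw [Finset.sum_comm]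
      simp only [← Finset.sum_add_distrib, h1, Finset.smul_sum]
      refine Finset.sum_congr rfl fun i _ => ?_
      rw [dUp, Finset.sum_mul, Finset.smul_sum]
      refine Finset.sum_congr rfl fun j _ => ?_
      rw [d_mul_d η j i, ← add_mul, g_mul_g, ← Algebra.smul_def, smul_mul_assoc, smul_smul,
        d_mul_d η j i]
    exact (smul_right_injective (WC η) (two_ne_zero (α := ℂ))) h2
  simp only [X, E, smul_mul_smul_comm, c_sq, Finset.sum_mul_sum, h]

/-- `X` acts locally nilpotently modulo the left ideal generated by `X`. -/
theorem X_nilpotent (a : WC η) : ∀ k : ℕ, ∃ m : ℕ, ∃ b, X η ^ m * a = b * X η ^ k := by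
  induction a using WC.ind η with
  | hc c => exact fun k => ⟨k, _, (Algebra.commutes c _).symm⟩
  | hd i =>
    have h : Commute (X η) (d η i) := X_mul_d η i
    exact fun k => ⟨k, _, (h.pow_left k).eq⟩
  | hg i =>
    have h0 : X η ^ 2 * g η i = g η i * X η ^ 2 := by
      have h1 := X_mul_g η i
      have h2 : X η * (X η * g η i + g η i * X η) = (X η * g η i + g η i * X η) * X η := by
        rw [h1]
        simp only [smul_mul_assoc, mul_smul_comm, Finset.sum_mul, Finset.mul_sum, X_mul_d]
      rw [mul_add, add_mul, ← mul_assoc, ← mul_assoc] at h2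
      have h3 : X η * X η * g η i = g η i * X η * X η := by
        rw [add_comm] at h2
        exact add_left_cancel h2
      rw [pow_two, h3, mul_assoc]
    have h : Commute (X η ^ 2) (g η i) := h0
    intro k
    refine ⟨2 * k, g η i * X η ^ k, ?_⟩
    rw [pow_mul, (h.pow_left k).eq, ← pow_mul, two_mul, pow_add, mul_assoc]
  | hx i =>
    -- `X² x = x X² + D` with `D` commuting with `X`
    obtain ⟨D, hD, hx⟩ : ∃ D, Commute (X η ^ 2) D ∧ X η ^ 2 * x η i = x η i * X η ^ 2 + D := by
      refine ⟨(Complex.I / (Real.sqrt 2 : ℂ)) • (X η * g η i + g η i * X η), ?_, ?_⟩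
      · refine Commute.pow_left ?_ 2
        rw [X_mul_g]
        refine (Commute.smul_right ?_ _).smul_right _
        refine Commute.sum_right _ _ _ fun j _ => ?_
        have : Commute (X η) (d η j) := X_mul_d η j
        exact this.smul_right _
      · rw [pow_two, mul_assoc, X_mul_x, mul_add, ← mul_assoc, X_mul_x, add_mul, mul_smul_comm,
          smul_mul_assoc, smul_add]
        simp only [mul_assoc]
        abel
    have h : ∀ k : ℕ, ∃ b, (X η ^ 2) ^ (k + 1) * x η i = b * (X η ^ 2) ^ k := by
      intro k
      have h1 : ∀ k : ℕ, (X η ^ 2) ^ (k + 1) * x η i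
          = x η i * (X η ^ 2) ^ (k + 1) + (k + 1 : ℕ) * D * (X η ^ 2) ^ k := by
        intro k
        induction k with
        | zero => simpa using hx
        | succ k ih =>
          rw [pow_succ' _ (k + 1), mul_assoc, ih, mul_add, ← mul_assoc, hx, add_mul,
            ← mul_assoc, ← mul_assoc, ← (Nat.cast_commute (k + 1) (X η ^ 2)).eq,
            mul_assoc _ _ D, hD.eq]
          simp only [pow_succ' _ k, Nat.cast_add, Nat.cast_one, mul_assoc,
            add_mul, one_mul]
          abel
      exact ⟨x η i * X η ^ 2 + (k + 1 : ℕ) * D, by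
        rw [h1, pow_succ' _ k, add_mul]; simp only [mul_assoc]⟩
    intro k
    obtain ⟨b, hb⟩ := h k
    refine ⟨2 * (k + 1), b * X η ^ k, ?_⟩
    rw [pow_mul, hb, ← pow_mul, two_mul, pow_add, mul_assoc]
  | hmul a b ha hb =>
    intro k
    obtain ⟨m1, b1, h1⟩ := hb k
    obtain ⟨m2, b2, h2⟩ := ha m1
    exact ⟨m2, b2 * b1, by rw [← mul_assoc, h2, mul_assoc, h1, mul_assoc]⟩
  | hadd a b ha hb =>
    intro k
    obtain ⟨m1, b1, h1⟩ := ha k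
    obtain ⟨m2, b2, h2⟩ := hb k
    refine ⟨m1 + m2, X η ^ m2 * b1 + X η ^ m1 * b2, ?_⟩
    rw [mul_add, add_mul, mul_assoc, mul_assoc, ← h1, ← h2, ← mul_assoc, ← mul_assoc,
      ← pow_add, ← pow_add, add_comm m2]

/-! ### The extremal projector -/

/-- `κ_k(h) = -k/2` for even `k` and `κ_k(h) = h + (k+1)/2` for odd `k`. -/
noncomputable def kappa (h : LWC η) (k : ℕ) : LWC η :=
  if Even k then algebraMap ℂ (LWC η) (-(k : ℂ) / 2)
  else h + algebraMap ℂ (LWC η) (((k : ℂ) + 1) / 2)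

/-- `φ_k(h) = ∏_{j=1}^k (-1)^j / κ_j(h)`. -/
noncomputable def phi (h : LWC η) (k : ℕ) : LWC η :=
  ((List.range k).map fun j => (-1) ^ (j + 1) * Ring.inverse (kappa η h (j + 1))).prod

/-- The action of `P = ∑_k φ_k(H) Y^k X^k` on a (locally `X`-nilpotent) `A'`-module. -/
noncomputable def extremalProjector {V : Type*} [AddCommGroup V] [Module (LWC η) V] (v : V) : V :=
  ∑ᶠ k : ℕ, (phi η (loc η (H η)) k * loc η (Y η) ^ k * loc η (X η) ^ k) • v

/-- The left ideal `I' = A' g₊` of `A'`, where `g₊` is spanned by `X` and `E`. -/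
noncomputable def I' : Ideal (LWC η) := Ideal.span {loc η (X η), loc η (E η)}

/-- The left `A'`-module `M' = A' / I'`. -/
abbrev M' : Type := LWC η ⧸ I' η

/-- The coset `a + I'`. -/
noncomputable def coset : LWC η →ₗ[LWC η] M' η := (I' η).mkQ

/-- The normalizer `{a : J a ⊆ J}` of a left ideal `J`. -/
def normalizer {R : Type*} [Ring R] (J : Ideal R) : Subring R where
  carrier := {a | ∀ b ∈ J, b * a ∈ J}
  mul_mem' := fun {a c} ha hc b hb => by rw [← mul_assoc]; exact hc _ (ha b hb)
  one_mem' := fun b hb => by rwa [mul_one]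
  add_mem' := fun {a c} ha hc b hb => by rw [mul_add]; exact add_mem (ha b hb) (hc b hb)
  zero_mem' := fun b _ => by rw [mul_zero]; exact zero_mem _
  neg_mem' := fun {a} ha b hb => by rw [mul_neg]; exact neg_mem (ha b hb)

/-- `I'` as an ideal of its normalizer. -/
noncomputable def idealInNormalizer : Ideal (normalizer (I' η)) :=
  (I' η).comap (normalizer (I' η)).subtype

instance : (idealInNormalizer η).IsTwoSided :=
  ⟨fun {a} b ha => b.2 a.1 ha⟩

/-- The localized reduction algebra `Z' = N(I') / I'`. -/
abbrev Z' : Type := normalizer (I' η) ⧸ idealInNormalizer η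

/-- The inclusion `Z' = N(I') / I' ⊆ A' / I'`, `a + I' ↦ a + I'`. -/
noncomputable def toCoset : Z' η →+ M' η :=
  QuotientAddGroup.map _ _ (normalizer (I' η)).subtype.toAddMonoidHom (fun _ h => h)

theorem toCoset_mk (a : normalizer (I' η)) :
    toCoset η (Ideal.Quotient.mk _ a) = coset η a := rfl

theorem toCoset_injective : Function.Injective (toCoset η) := by
  rw [injective_iff_map_eq_zero]
  intro z hz
  obtain ⟨a, rfl⟩ := Ideal.Quotient.mk_surjective z
  rw [toCoset_mk] at hz
  rw [Ideal.Quotient.eq_zero_iff_mem]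
  exact (Submodule.Quotient.mk_eq_zero (I' η)).mp hz

theorem mem_I'_iff {a : LWC η} : a ∈ I' η ↔ ∃ b, b * loc η (X η) = a := by
  have h : I' η = Ideal.span {loc η (X η)} := by
    refine le_antisymm (Ideal.span_le.mpr ?_) (Ideal.span_mono (by simp))
    rintro _ (rfl | rfl)
    · exact Ideal.subset_span rfl
    · rw [← X_sq, map_mul]
      exact Ideal.mul_mem_left _ _ (Ideal.subset_span rfl)
  rw [h, Ideal.mem_span_singleton']

/-- The `g₊`-invariants `{v : g₊ v = 0}` of an `A'`-module. -/
def invariants (V : Type*) [AddCommGroup V] [Module (LWC η) V] : Set V :=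
  {v | loc η (X η) • v = 0 ∧ loc η (E η) • v = 0}

theorem coset_mem_invariants {a : LWC η} :
    coset η a ∈ invariants η (M' η) ↔ a ∈ normalizer (I' η) := by
  have h1 : ∀ b : LWC η, b • coset η a = 0 ↔ b * a ∈ I' η := by
    intro b
    rw [← map_smul, smul_eq_mul]
    exact Submodule.Quotient.mk_eq_zero _
  constructor
  · rintro ⟨h, _⟩ b hb
    obtain ⟨c, rfl⟩ := (mem_I'_iff η).mp hb
    rw [mul_assoc]
    exact Ideal.mul_mem_left _ _ ((h1 _).mp h)
  · intro h
    exact ⟨(h1 _).mpr (h _ (Ideal.subset_span (by simp))),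
      (h1 _).mpr (h _ (Ideal.subset_span (by simp)))⟩

/-- The identification of `(M')⁺` with `Z'`: the invariant coset `a + I'` lies in `N(I') / I'`. -/
noncomputable def ofInvariant (v : M' η) (hv : v ∈ invariants η (M' η)) : Z' η :=
  Ideal.Quotient.mk _ ⟨Quotient.out v, (coset_mem_invariants η).mp (by
    have h : coset η (Quotient.out v) = v := Quotient.out_eq v
    rwa [h])⟩

theorem toCoset_ofInvariant (v : M' η) (hv : v ∈ invariants η (M' η)) :
    toCoset η (ofInvariant η v hv) = v := Quotient.out_eq v

theorem exists_X_pow_smul (v : M' η) : ∃ k : ℕ, loc η (X η) ^ k • v = 0 := by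
  obtain ⟨a, rfl⟩ : ∃ a, coset η a = v := Submodule.mkQ_surjective _ v
  obtain ⟨s, hs, r, hr⟩ := exists_loc η a
  obtain ⟨k, b, hk⟩ := X_nilpotent η r 1
  have h1 : ∀ k : ℕ, ∃ s' ∈ D η, s' * X η ^ k = X η ^ k * s := by
    intro k
    induction k with
    | zero => exact ⟨s, hs, by simp⟩
    | succ k ih =>
      obtain ⟨t, ht, h⟩ := ih
      obtain ⟨u, hu, h'⟩ := shift_D η (X_mul_H η) ht
      exact ⟨u, hu, by rw [pow_succ', ← mul_assoc, h', mul_assoc, h, mul_assoc]⟩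
  obtain ⟨s', hs', h2⟩ := h1 k
  refine ⟨k, ?_⟩
  rw [← map_smul, smul_eq_mul]
  refine (Submodule.Quotient.mk_eq_zero _).mpr ?_
  obtain ⟨u, hu⟩ := isUnit_loc η hs'
  have h3 : (u : LWC η) * (loc η (X η) ^ k * a) = loc η b * loc η (X η) := by
    rw [hu, ← mul_assoc, ← map_pow, ← map_mul, h2, map_mul, mul_assoc, hr, ← map_mul, hk,
      pow_one, map_mul]
  have h4 : loc η (X η) ^ k * a = ((u⁻¹ : (LWC η)ˣ) : LWC η) * loc η b * loc η (X η) := by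
    rw [mul_assoc, ← h3, Units.inv_mul_cancel_left]
  rw [h4]
  exact (mem_I'_iff η).mpr ⟨_, rfl⟩

theorem isUnit_H_add (k : ℤ) : IsUnit (loc η (H η) + algebraMap ℂ (LWC η) k) := by
  have h := isUnit_loc η (mem_D η k)
  rwa [map_add, map_intCast, ← map_intCast (algebraMap ℂ (LWC η))] at h

theorem isUnit_kappa (w : ℤ) (k : ℕ) :
    IsUnit (kappa η (loc η (H η) + algebraMap ℂ (LWC η) w) (k + 1)) := by
  unfold kappa
  split_ifs with h
  · refine IsUnit.map _ (IsUnit.mk0 _ ?_)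
    have : ((k + 1 : ℕ) : ℂ) ≠ 0 := Nat.cast_ne_zero.mpr (Nat.succ_ne_zero k)
    exact div_ne_zero (neg_ne_zero.mpr this) two_ne_zero
  · rw [Nat.not_even_iff_odd] at h
    obtain ⟨l, hl⟩ := h
    rw [hl, add_assoc, ← map_add]
    have h1 : (w : ℂ) + (((2 * l + 1 : ℕ) : ℂ) + 1) / 2 = ((w + l + 1 : ℤ) : ℂ) := by
      push_cast; ring
    rw [h1]
    exact isUnit_H_add η _

theorem phi_succ (h : LWC η) (k : ℕ) :
    phi η h (k + 1) = phi η h k * ((-1) ^ (k + 1) * Ring.inverse (kappa η h (k + 1))) := by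
  simp [phi, List.range_succ]

theorem X_mul_phi (k : ℕ) :
    loc η (X η) * phi η (loc η (H η)) k
      = phi η (loc η (H η) + algebraMap ℂ (LWC η) (-1 : ℤ)) k * loc η (X η) := by
  have hH : loc η (X η) * loc η (H η)
      = (loc η (H η) + algebraMap ℂ (LWC η) (-1 : ℤ)) * loc η (X η) := by
    rw [← map_mul, X_mul_H, map_mul, map_add, map_intCast, map_intCast]
  have hk : ∀ j, loc η (X η) * kappa η (loc η (H η)) j
      = kappa η (loc η (H η) + algebraMap ℂ (LWC η) (-1 : ℤ)) j * loc η (X η) := by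
    intro j
    unfold kappa
    split_ifs
    · rw [Algebra.commutes]
    · rw [mul_add, hH, add_mul _ (algebraMap ℂ (LWC η) (((j : ℂ) + 1) / 2)), Algebra.commutes]
  induction k with
  | zero => simp [phi]
  | succ k ih =>
    have hu : IsUnit (kappa η (loc η (H η)) (k + 1)) := by
      simpa using isUnit_kappa η 0 k
    have hu' := isUnit_kappa η (-1) k
    have hi : loc η (X η) * Ring.inverse (kappa η (loc η (H η)) (k + 1))
        = Ring.inverse (kappa η (loc η (H η) + algebraMap ℂ (LWC η) (-1 : ℤ)) (k + 1))
          * loc η (X η) := by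
      symm
      rw [Ring.eq_mul_inverse_iff_mul_eq _ _ _ hu, mul_assoc, hk, ← mul_assoc,
        Ring.inverse_mul_cancel _ hu', one_mul]
    have hc : Commute (loc η (X η)) ((-1) ^ (k + 1)) :=
      (Commute.neg_one_right _).pow_right _
    rw [phi_succ, phi_succ, ← mul_assoc, ih, mul_assoc, ← mul_assoc (loc η (X η)), hc.eq,
      mul_assoc _ (loc η (X η)), hi]
    simp only [mul_assoc]

theorem Y_pow_mul_H (k : ℕ) :
    loc η (Y η) ^ k * loc η (H η) = (loc η (H η) + (k : LWC η)) * loc η (Y η) ^ k := by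
  have h : loc η (Y η) * loc η (H η) = (loc η (H η) + 1) * loc η (Y η) := by
    rw [← map_mul, Y_mul_H, map_mul, map_add, map_intCast, Int.cast_one]
  induction k with
  | zero => simp
  | succ k ih =>
    rw [pow_succ', mul_assoc, ih, ← mul_assoc, mul_add, h, ← (Nat.cast_commute k _).eq, ← add_mul,
      mul_assoc, Nat.cast_succ, add_assoc, add_comm (1 : LWC η)]

theorem kappa_succ (k : ℕ) :
    (-1) ^ k * (loc η (H η) + (k : LWC η))
        + kappa η (loc η (H η) + algebraMap ℂ (LWC η) (-1 : ℤ)) k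
      = kappa η (loc η (H η) + algebraMap ℂ (LWC η) (-1 : ℤ)) (k + 1) := by
  unfold kappa
  rw [← map_natCast (algebraMap ℂ (LWC η))]
  rcases Nat.even_or_odd k with h | h
  · rw [if_pos h, if_neg (by simpa [Nat.even_add_one] using h), h.neg_one_pow, one_mul, add_assoc,
      add_assoc, ← map_add, ← map_add]
    congr 2
    push_cast; ring
  · rw [if_neg (Nat.not_even_iff_odd.mpr h), if_pos (by simpa [Nat.even_add_one] using h),
      h.neg_one_pow, neg_mul, one_mul, neg_add, add_assoc (loc η (H η)), ← map_add,
      add_add_add_comm, neg_add_cancel, zero_add, ← map_neg (algebraMap ℂ (LWC η)), ← map_add]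
    congr 1
    push_cast; ring

theorem X_mul_Y_pow (k : ℕ) :
    loc η (X η) * loc η (Y η) ^ (k + 1) = (-1) ^ (k + 1) * loc η (Y η) ^ (k + 1) * loc η (X η)
      + kappa η (loc η (H η) + algebraMap ℂ (LWC η) (-1 : ℤ)) (k + 1) * loc η (Y η) ^ k := by
  have h : loc η (X η) * loc η (Y η) = loc η (H η) - loc η (Y η) * loc η (X η) := by
    rw [← map_mul, ← map_mul, ← map_sub, ← XY_add_YX, add_sub_cancel_right]
  induction k with
  | zero =>
    rw [zero_add, pow_one, pow_zero, mul_one, h, ← kappa_succ]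
    simp [kappa]
    abel
  | succ k ih =>
    rw [pow_succ (loc η (Y η)) (k + 1), ← mul_assoc, ih, add_mul, mul_assoc _ (loc η (X η)), h,
      mul_sub, mul_assoc _ _ (loc η (H η)), Y_pow_mul_H, ← kappa_succ η (k + 1), add_mul,
      pow_succ (-1 : LWC η) (k + 1), pow_succ (loc η (Y η)) k]
    generalize kappa η (loc η (H η) + algebraMap ℂ (LWC η) (-1 : ℤ)) (k + 1) = K
    generalize (-1 : LWC η) ^ (k + 1) = s
    simp only [mul_assoc, neg_mul, one_mul, mul_neg, mul_add, add_mul]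
    abel

theorem X_smul_extremalProjector (v : M' η) : loc η (X η) • extremalProjector η v = 0 := by
  obtain ⟨N, hN⟩ := exists_X_pow_smul η v
  have hN' : ∀ k, N ≤ k → loc η (X η) ^ k • v = 0 := by
    intro k hk
    rw [← Nat.sub_add_cancel hk, pow_add, mul_smul, hN, smul_zero]
  have hs : extremalProjector η v = ∑ k ∈ Finset.range (N + 1),
      (phi η (loc η (H η)) k * loc η (Y η) ^ k * loc η (X η) ^ k) • v := by
    refine finsum_eq_sum_of_support_subset _ fun k hk => ?_
    by_contra hk'
    rw [Finset.coe_range, Set.mem_Iio, not_lt] at hk'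
    exact hk (by simp only [mul_smul, hN' k (by omega), smul_zero])
  have ht : ∀ N : ℕ, ∑ k ∈ Finset.range (N + 1),
      loc η (X η) * (phi η (loc η (H η)) k * loc η (Y η) ^ k * loc η (X η) ^ k)
      = phi η (loc η (H η) + algebraMap ℂ (LWC η) (-1 : ℤ)) N
        * ((-1) ^ N * loc η (Y η) ^ N * loc η (X η) ^ (N + 1)) := by
    intro N
    induction N with
    | zero => simp [phi]
    | succ N ih =>
      have hu := isUnit_kappa η (-1) N
      have h1 : phi η (loc η (H η) + algebraMap ℂ (LWC η) (-1 : ℤ)) (N + 1)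
          * kappa η (loc η (H η) + algebraMap ℂ (LWC η) (-1 : ℤ)) (N + 1)
          = phi η (loc η (H η) + algebraMap ℂ (LWC η) (-1 : ℤ)) N * (-1) ^ (N + 1) := by
        rw [phi_succ, mul_assoc, mul_assoc, Ring.inverse_mul_cancel _ hu, mul_one]
      have h2 : loc η (X η) * (phi η (loc η (H η)) (N + 1) * loc η (Y η) ^ (N + 1)
            * loc η (X η) ^ (N + 1))
          = (phi η (loc η (H η) + algebraMap ℂ (LWC η) (-1 : ℤ)) (N + 1)
              * (loc η (X η) * loc η (Y η) ^ (N + 1))) * loc η (X η) ^ (N + 1) := by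
        simp only [← mul_assoc, X_mul_phi]
      rw [Finset.sum_range_succ, ih, h2, X_mul_Y_pow, mul_add, ← mul_assoc _ (kappa η _ _), h1,
        add_mul]
      simp only [pow_succ' (loc η (X η)) (N + 1), pow_succ (-1 : LWC η) N, mul_assoc, neg_mul,
        one_mul, mul_neg]
      abel
  rw [hs, Finset.smul_sum]
  simp only [← mul_smul (loc η (X η))]
  rw [← Finset.sum_smul, ht, mul_smul, mul_smul, hN' _ (Nat.le_succ N), smul_zero, smul_zero]

theorem extremalProjector_mem (v : M' η) : extremalProjector η v ∈ invariants η (M' η) := by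
  have h := X_smul_extremalProjector η v
  refine ⟨h, ?_⟩
  rw [← X_sq, map_mul, mul_smul, h, smul_zero]

theorem H_mem_normalizer : loc η (H η) ∈ normalizer (I' η) := by
  intro b hb
  obtain ⟨c, rfl⟩ := (mem_I'_iff η).mp hb
  refine (mem_I'_iff η).mpr ⟨c * (loc η (H η) + ((-1 : ℤ) : LWC η)), ?_⟩
  rw [mul_assoc, mul_assoc, ← map_intCast (loc η), ← map_add, ← map_mul, ← map_mul, X_mul_H]

/-- The class `H + I'` in `Z'`. -/
noncomputable def HZ : Z' η := Ideal.Quotient.mk _ ⟨loc η (H η), H_mem_normalizer η⟩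

/-- The extremal projector `P : A' / I' → (A' / I')⁺ = Z'`. -/
noncomputable def P (v : M' η) : Z' η :=
  ofInvariant η (extremalProjector η v) (extremalProjector_mem η v)

/-- The raising operator `(H + 1) P(x^i)` in `Z'`. -/
noncomputable def xHat (i : Fin n) : Z' η := (HZ η + 1) * P η (coset η (loc η (x η i)))

/-- `F̃ = x_k x^k`. -/
noncomputable def Ftilde : WC η := ∑ k, xLow η k * x η k

/-- `Ỹ = x_k γ^k`. -/
noncomputable def Ytilde : WC η := ∑ k, xLow η k * g η k

/-! ### The brackets `[η^a x^r γ^s ∂^t; i_1, …, i_m]` -/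

/-- The `2a + r + s + t` positions of indices in a monomial `η^a x^r γ^s ∂^t`: a pair for each
`η`, and one for each `x`, `γ` and `∂`. -/
abbrev Slots (a r s t : ℕ) : Type := (Fin a × Fin 2) ⊕ Fin r ⊕ Fin s ⊕ Fin t

/-- The permutation of the positions given by `σa` permuting the pairs of indices of the `η`'s,
`τ k` permuting the two indices of the pair that is moved from `k`, and `σr`, `σt` permuting the
`x`'s and the `∂`'s. -/
def slotPerm {a r s t : ℕ} (τ : Fin a → Equiv.Perm (Fin 2)) (σa : Equiv.Perm (Fin a))
    (σr : Equiv.Perm (Fin r)) (σt : Equiv.Perm (Fin t)) : Equiv.Perm (Slots a r s t) :=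
  Equiv.sumCongr (Equiv.prodShear σa τ)
    (Equiv.sumCongr σr (Equiv.sumCongr (Equiv.refl _) σt))

/-- The group `((S₂)^a ⋊ S_a) × S_r × (S₁)^s × S_t` of permutations of the positions. -/
def slotGroup (a r s t : ℕ) : Subgroup (Equiv.Perm (Slots a r s t)) where
  carrier := {p | ∃ τ σa σr σt, p = slotPerm τ σa σr σt}
  mul_mem' := by
    rintro _ _ ⟨τ, σa, σr, σt, rfl⟩ ⟨τ', σa', σr', σt', rfl⟩
    refine ⟨fun k => τ (σa' k) * τ' k, σa * σa', σr * σr', σt * σt', ?_⟩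
    ext (⟨k, e⟩ | k | k | k) <;> rfl
  one_mem' := by
    refine ⟨fun _ => 1, 1, 1, 1, ?_⟩
    ext (⟨k, e⟩ | k | k | k) <;> rfl
  inv_mem' := by
    rintro _ ⟨τ, σa, σr, σt, rfl⟩
    refine ⟨fun k => (τ (σa⁻¹ k))⁻¹, σa⁻¹, σr⁻¹, σt⁻¹, ?_⟩
    ext (⟨k, e⟩ | k | k | k) <;> rfl

/-- The orbit equivalence on the fillings `α` of the positions by `1, …, m`, each used once. -/
def fillingSetoid (a r s t m : ℕ) : Setoid (Slots a r s t ≃ Fin m) where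
  r α β := ∃ p ∈ slotGroup a r s t, β = p.trans α
  iseqv :=
    { refl := fun α => ⟨1, one_mem _, rfl⟩
      symm := by
        rintro α _ ⟨p, hp, rfl⟩
        refine ⟨p⁻¹, inv_mem hp, ?_⟩
        ext u; simp
      trans := by
        rintro α _ _ ⟨p, hp, rfl⟩ ⟨q, hq, rfl⟩
        exact ⟨p * q, mul_mem hp hq, rfl⟩ }

/-- The monomial `(η^a x^r γ^s ∂^t)^{i_α}`. -/
noncomputable def monomial {a r s t m : ℕ} (i : Fin m → Fin n) (α : Slots a r s t ≃ Fin m) :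
    WC η :=
  (∏ k : Fin a, η.val (i (α (Sum.inl (k, 0)))) (i (α (Sum.inl (k, 1))))) •
    ((List.ofFn fun k : Fin r => x η (i (α (Sum.inr (Sum.inl k))))).prod
      * (List.ofFn fun k : Fin s => g η (i (α (Sum.inr (Sum.inr (Sum.inl k)))))).prod
      * (List.ofFn fun k : Fin t => dUp η (i (α (Sum.inr (Sum.inr (Sum.inr k)))))).prod)

theorem dUp_mul_dUp (i j : Fin n) : dUp η i * dUp η j = dUp η j * dUp η i := by
  simp only [dUp, Finset.sum_mul_sum, smul_mul_smul_comm]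
  rw [Finset.sum_comm]
  refine Finset.sum_congr rfl fun k _ => Finset.sum_congr rfl fun l _ => ?_
  rw [d_mul_d, mul_comm]

theorem prod_ofFn_perm {R : Type*} [Monoid R] {k : ℕ} (f : Fin k → R)
    (hf : ∀ a b, f a * f b = f b * f a) (σ : Equiv.Perm (Fin k)) :
    (List.ofFn fun j => f (σ j)).prod = (List.ofFn f).prod := by
  refine List.Perm.prod_eq' (Equiv.Perm.ofFn_comp_perm σ f) ?_
  exact List.pairwise_ofFn.mpr fun a b _ => hf _ _

theorem monomial_congr {a r s t m : ℕ} (i : Fin m → Fin n) (α β : Slots a r s t ≃ Fin m)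
    (h : (fillingSetoid a r s t m).r α β) : monomial η i α = monomial η i β := by
  rcases symm_or_subsingleton η with hs | hs
  swap
  · exact Subsingleton.elim _ _
  obtain ⟨_, ⟨τ, σa, σr, σt, rfl⟩, rfl⟩ := h
  have h2 : ∀ e : Equiv.Perm (Fin 2), e 0 = 0 ∧ e 1 = 1 ∨ e 0 = 1 ∧ e 1 = 0 := by decide
  have hη : ∏ k : Fin a, η.val (i (α (Sum.inl (σa k, τ k 0)))) (i (α (Sum.inl (σa k, τ k 1))))
      = ∏ k : Fin a, η.val (i (α (Sum.inl (k, 0)))) (i (α (Sum.inl (k, 1)))) := by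
    refine Eq.trans (Finset.prod_congr rfl fun k _ => ?_) (Equiv.prod_comp σa fun k : Fin a =>
      η.val (i (α (Sum.inl (k, 0)))) (i (α (Sum.inl (k, 1)))))
    rcases h2 (τ k) with ⟨h0, h1⟩ | ⟨h0, h1⟩
    · rw [h0, h1]
    · rw [h0, h1, hs]
  have hx := prod_ofFn_perm (fun k : Fin r => x η (i (α (Sum.inr (Sum.inl k)))))
    (fun _ _ => x_mul_x η _ _) σr
  have hd := prod_ofFn_perm (fun k : Fin t => dUp η (i (α (Sum.inr (Sum.inr (Sum.inr k))))))
    (fun _ _ => dUp_mul_dUp η _ _) σt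
  unfold monomial
  rw [← hη, ← hx, ← hd]
  rfl

open Classical in
/-- The bracket `[η^a x^r γ^s ∂^t; i_1, …, i_m]`, the sum of the monomials `(η^a x^r γ^s ∂^t)^{i_α}`
over the orbits `[α]`, and zero for negative `r`. -/
noncomputable def bracket {m : ℕ} (i : Fin m → Fin n) (a : ℕ) (r : ℤ) (s t : ℕ) : WC η :=
  if 0 ≤ r then
    ∑ c : Quotient (fillingSetoid a r.toNat s t m),
      Quotient.lift (monomial η i) (monomial_congr η i) c
  else 0

/-- `S_q^0 = ∑_{t=0}^q [η^t x^{m-q-t} ∂^{q-t}]`. -/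
noncomputable def S0 {m : ℕ} (i : Fin m → Fin n) (q : ℕ) : WC η :=
  ∑ t ∈ Finset.range (q + 1), bracket η i t ((m : ℤ) - q - t) 0 (q - t)

/-- `S_q^1 = ∑_{t=0}^{q-1} [η^t x^{m-q-t} γ ∂^{q-1-t}]`, for `q ≥ 1`. -/
noncomputable def S1 {m : ℕ} (i : Fin m → Fin n) (q : ℕ) : WC η :=
  ∑ t ∈ Finset.range q, bracket η i t ((m : ℤ) - q - t) 1 (q - 1 - t)

/-- `∏_{k=p+1}^m (H + k)`, a product of commuting factors. -/
noncomputable def risingH (p m : ℕ) : WC η :=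
  ((List.range' (p + 1) (m - p)).map fun k : ℕ => H η + (k : WC η)).prod

end WeylClifford

end DiracReduction

/-! The formula is the image of an exact identity in $\mathcal A$; cosets enter only to pass from
$\widehat{x^i}$ to a concrete representative.

Modulo $I'$, moving $X$ past $x^i$ gives a multiple of $\gamma^i$, moving it once more gives
$-\partial^i$, and $\partial^i$ commutes with $X$. So only the terms $k\le 2$ of $P(x^i)$ survive,
the factor $H+1$ clears their one denominator, and with $\tilde Y^2=\tilde F$ the class
$\widehat{x^i}$ is represented by $R^i=(H+1)x^i+\frac12\tilde Y\gamma^i+\frac12\tilde F\partial^i$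
(`coset_raise`). Products in $Z_n'$ may be computed with arbitrary representatives (`toCoset_mul`),
so it remains to order $R^{i_1}\cdots R^{i_m}$ normally.

This is an induction on $m$, multiplying by a new $R^j$ on the left (`prod_raise`). Since $R^j$ has
weight one for $H$, it shifts every factor $H+k$ to $H+k+1$. Passing $R^j$ through $\tilde F^q$ or
$\tilde F^{q-1}\tilde Y$ produces the same coefficient $H+q+1$ in front of $x^j$, exactly the factor
missing after the shift; the remaining terms raise $q$ by one and cost a factor $\frac12$. What is
left are the recursions in $m$ $S^0_{q+1}\leftarrow x^jS^0_{q+1}+\partial^jS^0_q$ and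
$S^1_{q+1}\leftarrow x^jS^1_{q+1}+\partial^jS^1_q+\gamma^jS^0_q$.

The recursions are combinatorial (`bracket_succ`, `bracketSum_succ`): sort the monomials by the
position of the first index. If it sits on an $\eta$, the sum is a commutator of $\partial^j$ with a
shorter bracket; added to the terms where it sits on a $\partial$, this turns right multiplication
by $\partial^j$ into left multiplication.

A nonsymmetric $\eta$ makes two equal anticommutators differ by a nonzero scalar, so $\mathcal A=0$
and every identity is trivial; hence the symmetry hypothesis in the intermediate lemmas. -/

namespace DiracReduction

section Reduction

variable {n : ℕ} (η : GL (Fin n) ℂ)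

/-! ### The raising operators -/

/-- The representative `(H + 1) x^i + ½ Ỹ γ^i + ½ F̃ ∂^i` of the raising operator. -/
noncomputable def raise (i : Fin n) : WC η :=
  (H η + 1) * x η i + (1 / 2 : ℂ) • (Ytilde η * g η i) + (1 / 2 : ℂ) • (Ftilde η * dUp η i)

/-! ### Multiplication in the reduction algebra through representatives -/

variable {η}

theorem coset_eq_zero_iff {a : LWC η} : coset η a = 0 ↔ a ∈ I' η :=
  Submodule.Quotient.mk_eq_zero _

/-- Write $a'b'-ab=(a'-a)b'+a(b'-b)$ with $a',b'$ in the normalizer. The first term stays in $I'$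
because $b'$ normalizes it, the second because $I'$ is a left ideal. Thus $a$ and $b$ need not be
shown to normalize $I'$. -/
theorem toCoset_mul {z w : Z' η} {a b : LWC η} (hz : toCoset η z = coset η a)
    (hw : toCoset η w = coset η b) : toCoset η (z * w) = coset η (a * b) := by
  obtain ⟨a', rfl⟩ := Ideal.Quotient.mk_surjective z
  obtain ⟨b', rfl⟩ := Ideal.Quotient.mk_surjective w
  rw [toCoset_mk, ← sub_eq_zero, ← map_sub, coset_eq_zero_iff] at hz hw
  rw [← map_mul, toCoset_mk, ← sub_eq_zero, ← map_sub, coset_eq_zero_iff]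
  have h : ((a' * b' : normalizer (I' η)) : LWC η) - a * b
      = ((a' : LWC η) - a) * b' + a * ((b' : LWC η) - b) := by
    rw [Subring.coe_mul]; noncomm_ring
  rw [h]
  exact add_mem (b'.2 _ hz) (Ideal.mul_mem_left _ _ hw)

theorem toCoset_list_prod {m : ℕ} (z : Fin m → Z' η) (a : Fin m → WC η)
    (h : ∀ k, toCoset η (z k) = coset η (loc η (a k))) :
    toCoset η (List.ofFn z).prod = coset η (loc η (List.ofFn a).prod) := by
  induction m with
  | zero =>
    rw [List.ofFn_zero, List.ofFn_zero, List.prod_nil, List.prod_nil, map_one (loc η)]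
    exact toCoset_mk η 1
  | succ m ih =>
    rw [List.ofFn_succ, List.ofFn_succ, List.prod_cons, List.prod_cons, map_mul (loc η)]
    exact toCoset_mul (h 0) (ih _ _ fun k => h k.succ)

/-! ### Commutation relations with $\tilde Y$ and $\tilde F$ -/

variable (η)

theorem g_mul_dUp (i j : Fin n) : g η i * dUp η j = dUp η j * g η i := by
  simp only [dUp, Finset.sum_mul, Finset.mul_sum, smul_mul_assoc, mul_smul_comm, g_mul_d]

theorem X_mul_dUp (i : Fin n) : X η * dUp η i = dUp η i * X η := by
  simp only [dUp, Finset.sum_mul, Finset.mul_sum, smul_mul_assoc, mul_smul_comm, X_mul_d]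

theorem dUp_mul_x (i j : Fin n) :
    dUp η i * x η j = x η j * dUp η i + algebraMap ℂ (WC η) (η.val i j) := by
  simp only [dUp, Finset.sum_mul, Finset.mul_sum, smul_mul_assoc, mul_smul_comm, d_mul_x,
    smul_add, Finset.sum_add_distrib, smul_ite, smul_zero, Finset.sum_ite_eq', Finset.mem_univ,
    if_true, Algebra.algebraMap_eq_smul_one]

theorem xLow_mul_x (i j : Fin n) : xLow η i * x η j = x η j * xLow η i := by
  simp only [xLow, Finset.sum_mul, Finset.mul_sum, smul_mul_assoc, mul_smul_comm, x_mul_x]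

theorem xLow_mul_xLow (i j : Fin n) : xLow η i * xLow η j = xLow η j * xLow η i := by
  conv_lhs => rw [xLow, Finset.sum_mul]
  conv_rhs => arg 2; rw [xLow]
  rw [Finset.mul_sum]
  simp only [smul_mul_assoc, mul_smul_comm, xLow_mul_x]

variable {η}

theorem inv_eta_mul_eta : (η⁻¹).val * η.val = 1 := by
  rw [← Units.val_mul, inv_mul_cancel]; rfl

theorem dUp_mul_xLow (hs : ∀ i j, η.val i j = η.val j i) (i j : Fin n) :
    dUp η i * xLow η j = xLow η j * dUp η i + (if i = j then 1 else 0) := by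
  have h1 : ∑ k, (η⁻¹).val j k * η.val i k = if i = j then 1 else 0 := by
    simp only [hs i, ← Matrix.mul_apply, inv_eta_mul_eta, Matrix.one_apply, eq_comm]
  simp only [xLow, Finset.sum_mul, Finset.mul_sum, smul_mul_assoc, mul_smul_comm, dUp_mul_x,
    smul_add, Finset.sum_add_distrib, Algebra.algebraMap_eq_smul_one, smul_smul, ← Finset.sum_smul,
    h1, ite_smul, one_smul, zero_smul]

theorem sum_two_eta_smul_xLow (hs : ∀ i j, η.val i j = η.val j i) (i : Fin n) :
    ∑ k, (2 * η.val k i) • xLow η k = (2 : ℂ) • x η i := by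
  simp only [← sum_eta_xLow η i, Finset.smul_sum, smul_smul, hs i]

theorem dUp_mul_Ytilde (hs : ∀ i j, η.val i j = η.val j i) (i : Fin n) :
    dUp η i * Ytilde η = Ytilde η * dUp η i + g η i := by
  simp only [Ytilde, Finset.mul_sum, Finset.sum_mul, ← mul_assoc, dUp_mul_xLow hs, add_mul]
  simp only [mul_assoc, g_mul_dUp, Finset.sum_add_distrib, ite_mul, one_mul, zero_mul,
    Finset.sum_ite_eq, Finset.mem_univ, if_true]

/-- By the Leibniz rule $\partial^i$ meets both factors of $x_kx^k$, and each contraction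
contributes one $x^i$. -/
theorem dUp_mul_Ftilde (hs : ∀ i j, η.val i j = η.val j i) (i : Fin n) :
    dUp η i * Ftilde η = Ftilde η * dUp η i + (2 : ℂ) • x η i := by
  have h : ∑ k, η.val i k • xLow η k = x η i := sum_eta_xLow η i
  simp only [Ftilde, Finset.mul_sum, Finset.sum_mul, ← mul_assoc, dUp_mul_xLow hs, add_mul]
  simp only [mul_assoc, dUp_mul_x, mul_add, ← Algebra.commutes, ← Algebra.smul_def,
    Finset.sum_add_distrib, ite_mul, one_mul, zero_mul,
    Finset.sum_ite_eq, Finset.mem_univ, if_true, h, two_smul]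
  abel

theorem g_mul_Ytilde (hs : ∀ i j, η.val i j = η.val j i) (i : Fin n) :
    g η i * Ytilde η = (2 : ℂ) • x η i - Ytilde η * g η i := by
  rw [eq_sub_iff_add_eq, ← sum_two_eta_smul_xLow hs]
  simp only [Ytilde, Finset.mul_sum, Finset.sum_mul, ← mul_assoc, g_mul_xLow,
    ← Finset.sum_add_distrib]
  refine Finset.sum_congr rfl fun k _ => ?_
  rw [mul_assoc, mul_assoc, ← mul_add, g_mul_g, ← Algebra.commutes, ← Algebra.smul_def, hs]

/-- As $x_kx_l$ is symmetric in $k,l$, adding the double sum to its transpose replaces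
$\gamma^k\gamma^l$ by the anticommutator $2\eta^{kl}$. -/
theorem Ytilde_sq (hs : ∀ i j, η.val i j = η.val j i) : Ytilde η * Ytilde η = Ftilde η := by
  have h : ∀ k l, xLow η k * g η k * (xLow η l * g η l)
      = xLow η k * xLow η l * (g η k * g η l) := by
    intro k l
    rw [mul_assoc, ← mul_assoc (g η k), g_mul_xLow, mul_assoc, mul_assoc]
  have h2 : (2 : ℂ) • (Ytilde η * Ytilde η) = (2 : ℂ) • Ftilde η := by
    rw [two_smul]
    conv_lhs => rw [Ytilde, Finset.sum_mul_sum]; arg 2; rw [Finset.sum_comm]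
    simp only [← Finset.sum_add_distrib, h, Ftilde, Finset.smul_sum]
    refine Finset.sum_congr rfl fun k _ => ?_
    rw [← mul_smul_comm, ← sum_two_eta_smul_xLow hs, Finset.mul_sum]
    refine Finset.sum_congr rfl fun l _ => ?_
    rw [xLow_mul_xLow η l k, ← mul_add, g_mul_g, ← Algebra.commutes, ← Algebra.smul_def,
      mul_smul_comm, hs]
  exact smul_right_injective (WC η) (two_ne_zero (α := ℂ)) h2

variable (η)

theorem x_mul_Ytilde (i : Fin n) : x η i * Ytilde η = Ytilde η * x η i := by
  simp only [Ytilde, Finset.mul_sum, Finset.sum_mul, mul_assoc, g_mul_x]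
  simp only [← mul_assoc, xLow_mul_x]

theorem x_mul_Ftilde (i : Fin n) : x η i * Ftilde η = Ftilde η * x η i := by
  simp only [Ftilde, Finset.mul_sum, Finset.sum_mul]
  refine Finset.sum_congr rfl fun k _ => ?_
  rw [← mul_assoc, ← xLow_mul_x, mul_assoc, x_mul_x, mul_assoc]

theorem g_mul_Ftilde (i : Fin n) : g η i * Ftilde η = Ftilde η * g η i := by
  simp only [Ftilde, Finset.mul_sum, Finset.sum_mul, mul_assoc, ← g_mul_x]
  simp only [← mul_assoc, g_mul_xLow]

theorem Ytilde_mul_Ftilde : Ytilde η * Ftilde η = Ftilde η * Ytilde η := by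
  have h : ∀ k, xLow η k * Ftilde η = Ftilde η * xLow η k := by
    intro k
    simp only [xLow, Finset.mul_sum, Finset.sum_mul, smul_mul_assoc, mul_smul_comm, x_mul_Ftilde]
  simp only [Ytilde, Finset.mul_sum, Finset.sum_mul, mul_assoc, g_mul_Ftilde]
  simp only [← mul_assoc, h]

theorem Y_eq : Y η = (Complex.I / (Real.sqrt 2 : ℂ)) • Ytilde η := by
  simp only [Y, Ytilde, g_mul_xLow]

/-! ### The raising operators applied to normally ordered elements -/

theorem Ftilde_mul_H : Ftilde η * H η = (H η + ((2 : ℤ) : WC η)) * Ftilde η := by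
  have h : ∀ k, xLow η k * x η k * H η = (H η + ((2 : ℤ) : WC η)) * (xLow η k * x η k) := by
    intro k
    rw [mul_assoc, x_mul_H, ← mul_assoc, mul_add, xLow_mul_H, ← (Int.cast_commute 1 _).eq,
      ← add_mul, mul_assoc, add_assoc, ← Int.cast_add]
    norm_num
  simp only [Ftilde, Finset.sum_mul, Finset.mul_sum, h]

theorem Ytilde_mul_H : Ytilde η * H η = (H η + ((1 : ℤ) : WC η)) * Ytilde η := by
  have h : ∀ k, xLow η k * g η k * H η = (H η + ((1 : ℤ) : WC η)) * (xLow η k * g η k) := by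
    intro k
    have h0 := g_mul_H η k
    rw [Int.cast_zero, add_zero] at h0
    rw [mul_assoc, h0, ← mul_assoc, xLow_mul_H, mul_assoc]
  simp only [Ytilde, Finset.sum_mul, Finset.mul_sum, h]

theorem dUp_mul_H (i : Fin n) : dUp η i * H η = (H η + ((-1 : ℤ) : WC η)) * dUp η i := by
  simp only [dUp, Finset.sum_mul, Finset.mul_sum, smul_mul_assoc, mul_smul_comm, d_mul_H]

/-- All three summands have weight one: $x^i$ and $\tilde Y$ have weight $1$, $\gamma^i$ has weight
$0$, $\tilde F$ has weight $2$ and $\partial^i$ has weight $-1$. -/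
theorem raise_mul_H (i : Fin n) : raise η i * H η = (H η + 1) * raise η i := by
  have h1 := x_mul_H η i
  have h2 := g_mul_H η i
  have h3 := dUp_mul_H η i
  have h4 := Ytilde_mul_H η
  have h5 := Ftilde_mul_H η
  rw [Int.cast_zero, add_zero] at h2
  have h6 : Ftilde η * dUp η i * H η = (H η + 1) * (Ftilde η * dUp η i) := by
    rw [mul_assoc, h3, ← mul_assoc, mul_add, h5, ← (Int.cast_commute (-1) _).eq, ← add_mul,
      mul_assoc, add_assoc, ← Int.cast_add]
    norm_num
  have h7 : Ytilde η * g η i * H η = (H η + 1) * (Ytilde η * g η i) := by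
    rw [mul_assoc, h2, ← mul_assoc, h4, Int.cast_one, mul_assoc]
  have h8 : (H η + 1) * x η i * H η = (H η + 1) * ((H η + 1) * x η i) := by
    rw [mul_assoc, h1, Int.cast_one]
  rw [raise, add_mul, add_mul, smul_mul_assoc, smul_mul_assoc, h6, h7, h8, mul_add, mul_add,
    mul_smul_comm, mul_smul_comm]

theorem raise_mul_H_add (i : Fin n) (k : ℕ) :
    raise η i * (H η + (k : WC η)) = (H η + ((k + 1 : ℕ) : WC η)) * raise η i := by
  rw [mul_add, raise_mul_H, ← (Nat.cast_commute k _).eq, ← add_mul, Nat.cast_succ, add_assoc,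
    add_comm (1 : WC η)]

theorem raise_mul_risingH (i : Fin n) (q m : ℕ) :
    raise η i * risingH η q m = risingH η (q + 1) (m + 1) * raise η i := by
  unfold risingH
  rw [Nat.add_sub_add_right]
  generalize m - q = l
  induction l generalizing q with
  | zero => simp
  | succ l ih =>
    rw [List.range'_succ, List.range'_succ, List.map_cons, List.map_cons, List.prod_cons,
      List.prod_cons, ← mul_assoc, raise_mul_H_add, mul_assoc, ih, mul_assoc]

/-- Normal ordering produces the missing factor at the right end of the product, while it is the
first factor of the longer one; all of them lie in the commutative monoid `D`. -/
theorem risingH_succ_mul {q m : ℕ} (h : q < m) :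
    risingH η (q + 1) m * (H η + ((q + 1 : ℕ) : WC η)) = risingH η q m := by
  have h1 : ∀ k : ℕ, H η + (k : WC η) ∈ D η := fun k => by
    have := mem_D η k
    rwa [Int.cast_natCast] at this
  have h2 : risingH η (q + 1) m ∈ D η := by
    refine Submonoid.list_prod_mem _ fun a ha => ?_
    obtain ⟨k, _, rfl⟩ := List.mem_map.mp ha
    exact h1 k
  rw [D_comm η h2 (h1 _)]
  unfold risingH
  rw [show m - q = (m - (q + 1)) + 1 by omega, List.range'_succ, List.map_cons, List.prod_cons]

variable {η}

theorem dUp_mul_Ftilde_pow (hs : ∀ i j, η.val i j = η.val j i) (i : Fin n) (q : ℕ) :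
    dUp η i * Ftilde η ^ (q + 1)
      = Ftilde η ^ (q + 1) * dUp η i + (2 * ((q + 1 : ℕ) : ℂ)) • (Ftilde η ^ q * x η i) := by
  induction q with
  | zero => simp [dUp_mul_Ftilde hs]
  | succ q ih =>
    have h : x η i * Ftilde η ^ (q + 1) = Ftilde η ^ (q + 1) * x η i :=
      (show Commute _ _ from x_mul_Ftilde η i).pow_right (q + 1)
    rw [pow_succ' _ (q + 1), ← mul_assoc, dUp_mul_Ftilde hs, add_mul, mul_assoc, ih, mul_add,
      smul_mul_assoc, h, mul_smul_comm, ← mul_assoc, ← mul_assoc, ← pow_succ', ← pow_succ', add_assoc,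
      ← add_smul]
    congr 2
    push_cast; ring

/-- The commutator of $\partial^i$ with $\tilde F^q$ is $2q\tilde F^{q-1}x^i$; multiplied by
$\frac12\tilde F$ it adds $q$ to the coefficient $H+1$ of $\tilde F^qx^i$. -/
theorem raise_mul_Ftilde_pow (hs : ∀ i j, η.val i j = η.val j i) (i : Fin n) (q : ℕ) :
    raise η i * Ftilde η ^ q
      = (H η + ((q + 1 : ℕ) : WC η)) * (Ftilde η ^ q * x η i)
        + (1 / 2 : ℂ) • (Ftilde η ^ q * Ytilde η * g η i)
        + (1 / 2 : ℂ) • (Ftilde η ^ (q + 1) * dUp η i) := by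
  have hx : x η i * Ftilde η ^ q = Ftilde η ^ q * x η i :=
    (show Commute _ _ from x_mul_Ftilde η i).pow_right q
  have hg : g η i * Ftilde η ^ q = Ftilde η ^ q * g η i :=
    (show Commute _ _ from g_mul_Ftilde η i).pow_right q
  have hY : Ytilde η * Ftilde η ^ q = Ftilde η ^ q * Ytilde η :=
    (show Commute _ _ from Ytilde_mul_Ftilde η).pow_right q
  have hd : Ftilde η * (dUp η i * Ftilde η ^ q)
      = Ftilde η ^ (q + 1) * dUp η i + (2 * (q : ℂ)) • (Ftilde η ^ q * x η i) := by
    cases q with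
    | zero => simp
    | succ q =>
      rw [dUp_mul_Ftilde_pow hs, mul_add, mul_smul_comm, ← mul_assoc, ← mul_assoc, ← pow_succ',
        ← pow_succ']
  rw [raise, add_mul, add_mul, smul_mul_assoc, smul_mul_assoc, mul_assoc, hx, mul_assoc, hg,
    ← mul_assoc (Ytilde η), hY, mul_assoc (Ftilde η), hd, smul_add, smul_smul]
  rw [show (1 / 2 : ℂ) * (2 * (q : ℂ)) = q by ring, Nat.cast_smul_eq_nsmul, nsmul_eq_mul,
    Nat.cast_succ, add_comm (q : WC η), ← add_assoc (H η), add_mul (H η + 1) (q : WC η)]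
  abel

/-- Moving $\gamma^i$ past $\tilde Y$ yields $\tilde F^q\tilde Yx^i$, which raises $H+q+1$ to
$H+q+2$, and $-\frac12\tilde F^{q+1}\gamma^i$. The latter cancels against the $\gamma^i$ created
when $\partial^i$ passes $\tilde Y$, so no term free of $\tilde Y$ appears. -/
theorem raise_mul_Ftilde_pow_mul_Ytilde (hs : ∀ i j, η.val i j = η.val j i) (i : Fin n) (q : ℕ) :
    raise η i * (Ftilde η ^ q * Ytilde η)
      = (H η + ((q + 2 : ℕ) : WC η)) * (Ftilde η ^ q * Ytilde η * x η i)
        + (1 / 2 : ℂ) • (Ftilde η ^ (q + 1) * Ytilde η * dUp η i) := by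
  rw [← mul_assoc, raise_mul_Ftilde_pow hs, add_mul, add_mul, smul_mul_assoc, smul_mul_assoc]
  rw [mul_assoc (Ftilde η ^ (q + 1)), dUp_mul_Ytilde hs, mul_assoc _ (g η i), g_mul_Ytilde hs,
    mul_sub, mul_smul_comm, mul_assoc _ (Ytilde η) (Ytilde η * g η i), ← mul_assoc (Ytilde η),
    Ytilde_sq hs, ← mul_assoc _ (Ftilde η), ← pow_succ, mul_add, mul_assoc, mul_assoc _ (x η i),
    x_mul_Ytilde, smul_sub, smul_smul, smul_add]
  rw [show (1 / 2 : ℂ) * 2 = 1 by norm_num, one_smul, show q + 2 = q + 1 + 1 from rfl,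
    Nat.cast_succ (q + 1), ← add_assoc (H η), add_mul _ (1 : WC η), one_mul]
  simp only [mul_assoc]
  abel

variable (η)

/-! ### The raising operators in the localized reduction algebra -/

/-- With $c=\sqrt{-1}/\sqrt2$, commuting twice leaves $c(X\gamma^i+\gamma^iX)=2c^2\partial^i$, and
$c^2=-\frac12$. -/
theorem X_sq_mul_x (i : Fin n) : X η ^ 2 * x η i = x η i * X η ^ 2 - dUp η i := by
  rcases symm_or_subsingleton η with hs | hs
  swap
  · exact Subsingleton.elim _ _
  have h : X η * g η i + g η i * X η = (Complex.I / (Real.sqrt 2 : ℂ)) • (2 : ℂ) • dUp η i := by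
    rw [X_mul_g, dUp]
    congr 1
    simp only [mul_smul, Finset.smul_sum, hs i]
  rw [pow_two, mul_assoc, X_mul_x, mul_add, ← mul_assoc, X_mul_x, add_mul, mul_smul_comm,
    smul_mul_assoc, add_assoc, ← smul_add, add_comm (g η i * X η), h, smul_smul, smul_smul,
    c_sq, mul_assoc]
  norm_num [sub_eq_add_neg]

theorem coset_loc_mul_X (a : WC η) : coset η (loc η (a * X η)) = 0 :=
  coset_eq_zero_iff.mpr ((mem_I'_iff η).mpr ⟨loc η a, (map_mul _ _ _).symm⟩)

theorem loc_smul_coset (a b : WC η) :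
    loc η a • coset η (loc η b) = coset η (loc η (a * b)) := by
  rw [map_mul (loc η), ← smul_eq_mul, map_smul]

theorem coset_loc_X_mul_x (i : Fin n) : coset η (loc η (X η * x η i))
    = coset η (loc η ((Complex.I / (Real.sqrt 2 : ℂ)) • g η i)) := by
  rw [X_mul_x, map_add (loc η), map_add (coset η), coset_loc_mul_X, zero_add]

theorem coset_loc_X_sq_mul_x (i : Fin n) :
    coset η (loc η (X η ^ 2 * x η i)) = coset η (loc η (-dUp η i)) := by
  rw [X_sq_mul_x, sub_eq_add_neg, map_add (loc η), map_add (coset η), pow_two, ← mul_assoc,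
    coset_loc_mul_X, zero_add]

/-- Since $\partial^i$ commutes with $X$, a third factor $X$ can always be brought to the right end.
This cuts the projector applied to $x^i$ off after $k=2$. -/
theorem coset_loc_X_pow_mul_x (i : Fin n) (k : ℕ) :
    coset η (loc η (X η ^ (k + 3) * x η i)) = 0 := by
  have h : X η ^ (k + 3) * x η i
      = (X η ^ (k + 1) * x η i * X η - X η ^ k * dUp η i) * X η := by
    have h1 := X_mul_dUp η i
    rw [show k + 3 = (k + 1) + 2 from rfl, pow_add, mul_assoc, X_sq_mul_x, mul_sub, sub_mul,
      pow_succ (X η) k, mul_assoc _ _ (dUp η i), h1]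
    simp only [pow_two, mul_assoc]
  rw [h, coset_loc_mul_X]

theorem extremalProjector_x (i : Fin n) :
    extremalProjector η (coset η (loc η (x η i)))
      = coset η (loc η (x η i))
        + phi η (loc η (H η)) 1 • coset η (loc η
            (Y η * ((Complex.I / (Real.sqrt 2 : ℂ)) • g η i)))
        + phi η (loc η (H η)) 2 • coset η (loc η (Y η ^ 2 * -dUp η i)) := by
  have h : ∀ k, (phi η (loc η (H η)) k * loc η (Y η) ^ k * loc η (X η) ^ k)
      • coset η (loc η (x η i)) = phi η (loc η (H η)) k • loc η (Y η ^ k)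
        • coset η (loc η (X η ^ k * x η i)) := by
    intro k
    rw [mul_smul, mul_smul, ← map_pow, ← map_pow, loc_smul_coset]
  have hs : extremalProjector η (coset η (loc η (x η i)))
      = ∑ k ∈ Finset.range 3, (phi η (loc η (H η)) k * loc η (Y η) ^ k * loc η (X η) ^ k)
          • coset η (loc η (x η i)) := by
    refine finsum_eq_sum_of_support_subset _ fun k hk => ?_
    by_contra hk'
    rw [Finset.coe_range, Set.mem_Iio, not_lt] at hk'
    obtain ⟨l, rfl⟩ := Nat.exists_eq_add_of_le' hk'
    refine hk ?_
    dsimp only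
    rw [h, coset_loc_X_pow_mul_x, smul_zero, smul_zero]
  rw [hs, Finset.sum_range_succ, Finset.sum_range_succ, Finset.sum_range_one, h, h, h, pow_one,
    pow_one, coset_loc_X_mul_x, coset_loc_X_sq_mul_x, loc_smul_coset, loc_smul_coset,
    loc_smul_coset, pow_zero, pow_zero, one_mul, one_mul]
  simp [phi]

/-- The normalization of $\widehat{x^i}$ is chosen for this: $\kappa_1(H)=H+1$ is the only
denominator, as $\kappa_2=-1$. -/
theorem H_add_one_mul_phi_one : (loc η (H η) + 1) * phi η (loc η (H η)) 1 = -1 := by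
  have hu : IsUnit (loc η (H η) + 1) := by simpa using isUnit_H_add η 1
  have h : kappa η (loc η (H η)) 1 = loc η (H η) + 1 := by norm_num [kappa]
  simp [phi, h, Ring.mul_inverse_cancel _ hu]

theorem phi_two : phi η (loc η (H η)) 2 = -phi η (loc η (H η)) 1 := by
  have h : kappa η (loc η (H η)) 2 = -1 := by norm_num [kappa]
  have h1 : Ring.inverse (-1 : LWC η) = -1 :=
    Ring.inverse_unit (-1 : (LWC η)ˣ)
  rw [phi_succ η _ 1, h, h1]
  norm_num

theorem coset_raise (i : Fin n) :
    (loc η (H η) + 1) • extremalProjector η (coset η (loc η (x η i)))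
      = coset η (loc η (raise η i)) := by
  -- The scalars of $Y$ and $X$ multiply to $-\frac12$. The signs of this term and of the quadratic
  -- one are then corrected by $(H+1)\varphi_1=-1$ and $(H+1)\varphi_2=1$.
  have hY : Y η * ((Complex.I / (Real.sqrt 2 : ℂ)) • g η i)
      = -((1 / 2 : ℂ) • (Ytilde η * g η i)) := by
    rw [Y_eq, smul_mul_smul_comm, c_sq, neg_smul]
  have hY2 : Y η ^ 2 * -dUp η i = (1 / 2 : ℂ) • (Ftilde η * dUp η i) := by
    rcases symm_or_subsingleton η with hs | hs
    swap
    · exact Subsingleton.elim _ _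
    rw [pow_two, Y_eq, smul_mul_smul_comm, c_sq, Ytilde_sq hs, neg_smul, mul_neg, neg_mul, neg_neg,
      smul_mul_assoc]
  have h1 : loc η (H η) + 1 = loc η (H η + 1) := by rw [map_add, map_one]
  rw [extremalProjector_x, smul_add, smul_add, phi_two, smul_smul, smul_smul, mul_neg,
    H_add_one_mul_phi_one, neg_neg, one_smul, hY, hY2, neg_smul, one_smul, h1, loc_smul_coset,
    raise]
  simp only [map_add, map_neg, neg_neg]

theorem toCoset_xHat (i : Fin n) : toCoset η (xHat η i) = coset η (loc η (raise η i)) := by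
  obtain ⟨b, hb⟩ := Ideal.Quotient.mk_surjective (P η (coset η (loc η (x η i))))
  have h1 : toCoset η (HZ η + 1) = coset η (loc η (H η) + 1) := rfl
  have h2 : toCoset η (P η (coset η (loc η (x η i)))) = coset η b := by rw [← hb, toCoset_mk]
  rw [xHat, toCoset_mul h1 h2, ← smul_eq_mul, map_smul, ← h2, P, toCoset_ofInvariant, coset_raise]

end Reduction

section Brackets

/-! ### Fillings of positions by an index set with a distinguished element -/

/-- The extension of `β : S ≃ Fin m` to `S ∪ {∗} ≃ Fin (m + 1)` sending `∗` to `0`. -/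
def extendFilling {S S' : Type*} {m : ℕ} (e : S' ≃ Option S) (β : S ≃ Fin m) : S' ≃ Fin (m + 1) :=
  e.trans (β.optionCongr.trans (finSuccEquiv m).symm)

theorem extendFilling_none {S S' : Type*} {m : ℕ} (e : S' ≃ Option S) (β : S ≃ Fin m) {u : S'}
    (hu : e u = none) : extendFilling e β u = 0 := by
  simp [extendFilling, hu]

theorem extendFilling_some {S S' : Type*} {m : ℕ} (e : S' ≃ Option S) (β : S ≃ Fin m) {u : S'}
    {v : S} (hu : e u = some v) : extendFilling e β u = (β v).succ := by
  simp [extendFilling, hu]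

/-- A filling with $0$ at $u$ is determined by its values elsewhere. Stated for any `S' ≃ Option S`,
this serves all four kinds of position. -/
theorem sum_filling_zero {S S' M : Type*} [Fintype S] [Fintype S'] [DecidableEq S]
    [DecidableEq S'] [AddCommMonoid M] {m : ℕ} (e : S' ≃ Option S) {u : S'} (hu : e u = none)
    (f : (S' ≃ Fin (m + 1)) → M) :
    ∑ α with α u = 0, f α = ∑ β : S ≃ Fin m, f (extendFilling e β) := by
  symm
  refine Finset.sum_bij (fun β _ => extendFilling e β) ?_ ?_ ?_ fun _ _ => rfl
  · intro β _
    simpa using extendFilling_none e β hu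
  · intro β _ β' _ h
    refine Equiv.optionCongr_injective (Equiv.ext fun o => ?_)
    have h1 := congrArg (fun α : S' ≃ Fin (m + 1) => finSuccEquiv m (α (e.symm o))) h
    simpa [extendFilling] using h1
  · intro α hα
    have hα' : α u = 0 := by simpa using hα
    -- Read on `Option`, the filling fixes `none`, so removing `none` gives the preimage.
    have h0 : (e.symm.trans (α.trans (finSuccEquiv m))) none = none := by
      have : e.symm none = u := by rw [← hu, Equiv.symm_apply_apply]
      simp [this, hα']
    refine ⟨Equiv.removeNone (e.symm.trans (α.trans (finSuccEquiv m))), Finset.mem_univ _, ?_⟩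
    refine Equiv.ext fun w => ?_
    rcases h : e w with _ | v
    · rw [extendFilling_none e _ h, ← hα']
      rw [← hu] at h
      rw [e.injective h]
    · rw [extendFilling_some e _ h]
      refine (finSuccEquiv m).injective ?_
      rw [finSuccEquiv_succ]
      have h1 : e.symm (some v) = w := by rw [← h, Equiv.symm_apply_apply]
      have h2 : (e.symm.trans (α.trans (finSuccEquiv m))) (some v) = finSuccEquiv m (α w) := by
        simp [h1]
      rw [← h2, Equiv.removeNone_some]
      refine Option.ne_none_iff_exists'.mp fun h3 => ?_
      rw [← h0] at h3
      exact Option.some_ne_none v (Equiv.injective _ h3)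

theorem sum_filling {S M : Type*} [Fintype S] [DecidableEq S] [AddCommMonoid M] {m : ℕ}
    (f : (S ≃ Fin (m + 1)) → M) : ∑ α, f α = ∑ u, ∑ α with α u = 0, f α := by
  rw [← Finset.sum_fiberwise Finset.univ (fun α : S ≃ Fin (m + 1) => α.symm 0) f]
  refine Finset.sum_congr rfl fun u _ => Finset.sum_congr ?_ fun _ _ => rfl
  ext α
  simp only [Finset.mem_filter, Finset.mem_univ, true_and, Equiv.symm_apply_eq]
  exact eq_comm

/-! ### Removing one position -/

/-- The positions other than the first `x`. -/
def xSlotEquiv (a r s t : ℕ) : Slots a (r + 1) s t ≃ Option (Slots a r s t) where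
  toFun
    | Sum.inl p => some (Sum.inl p)
    | Sum.inr (Sum.inl k) => Fin.cases none (fun k => some (Sum.inr (Sum.inl k))) k
    | Sum.inr (Sum.inr p) => some (Sum.inr (Sum.inr p))
  invFun
    | none => Sum.inr (Sum.inl 0)
    | some (Sum.inl p) => Sum.inl p
    | some (Sum.inr (Sum.inl k)) => Sum.inr (Sum.inl k.succ)
    | some (Sum.inr (Sum.inr p)) => Sum.inr (Sum.inr p)
  left_inv := by
    rintro (p | k | p)
    · rfl
    · cases k using Fin.cases <;> rfl
    · rfl
  right_inv := by rintro (_ | p | k | p) <;> rfl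

/-- The positions other than the only `γ`. -/
def gSlotEquiv (a r t : ℕ) : Slots a r 1 t ≃ Option (Slots a r 0 t) where
  toFun
    | Sum.inl p => some (Sum.inl p)
    | Sum.inr (Sum.inl k) => some (Sum.inr (Sum.inl k))
    | Sum.inr (Sum.inr (Sum.inl _)) => none
    | Sum.inr (Sum.inr (Sum.inr k)) => some (Sum.inr (Sum.inr (Sum.inr k)))
  invFun
    | none => Sum.inr (Sum.inr (Sum.inl 0))
    | some (Sum.inl p) => Sum.inl p
    | some (Sum.inr (Sum.inl k)) => Sum.inr (Sum.inl k)
    | some (Sum.inr (Sum.inr (Sum.inl k))) => k.elim0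
    | some (Sum.inr (Sum.inr (Sum.inr k))) => Sum.inr (Sum.inr (Sum.inr k))
  left_inv := by
    rintro (p | k | k | k)
    · rfl
    · rfl
    · rw [Subsingleton.elim k 0]
    · rfl
  right_inv := by
    rintro (_ | p | k | k | k)
    · rfl
    · rfl
    · rfl
    · exact k.elim0
    · rfl

/-- The positions other than the first `∂`. -/
def dSlotEquiv (a r s t : ℕ) : Slots a r s (t + 1) ≃ Option (Slots a r s t) where
  toFun
    | Sum.inl p => some (Sum.inl p)
    | Sum.inr (Sum.inl k) => some (Sum.inr (Sum.inl k))
    | Sum.inr (Sum.inr (Sum.inl k)) => some (Sum.inr (Sum.inr (Sum.inl k)))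
    | Sum.inr (Sum.inr (Sum.inr k)) =>
      Fin.cases none (fun k => some (Sum.inr (Sum.inr (Sum.inr k)))) k
  invFun
    | none => Sum.inr (Sum.inr (Sum.inr 0))
    | some (Sum.inl p) => Sum.inl p
    | some (Sum.inr (Sum.inl k)) => Sum.inr (Sum.inl k)
    | some (Sum.inr (Sum.inr (Sum.inl k))) => Sum.inr (Sum.inr (Sum.inl k))
    | some (Sum.inr (Sum.inr (Sum.inr k))) => Sum.inr (Sum.inr (Sum.inr k.succ))
  left_inv := by
    rintro (p | k | k | k)
    · rfl
    · rfl
    · rfl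
    · cases k using Fin.cases <;> rfl
  right_inv := by rintro (_ | p | k | k | k) <;> rfl

/-- The positions other than the first index of the first `η`; the second index of this `η` is
replaced by an `x`. -/
def etaSlotEquiv (a r s t : ℕ) : Slots (a + 1) r s t ≃ Option (Slots a (r + 1) s t) where
  toFun
    | Sum.inl (k, e) => Fin.cases
        (Fin.cases (motive := fun _ => Option (Slots a (r + 1) s t)) none
          (fun _ => some (Sum.inr (Sum.inl 0))) e) (fun k => some (Sum.inl (k, e))) k
    | Sum.inr (Sum.inl k) => some (Sum.inr (Sum.inl k.succ))
    | Sum.inr (Sum.inr p) => some (Sum.inr (Sum.inr p))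
  invFun
    | none => Sum.inl (0, 0)
    | some (Sum.inl (k, e)) => Sum.inl (k.succ, e)
    | some (Sum.inr (Sum.inl k)) => Fin.cases (Sum.inl (0, 1)) (fun k => Sum.inr (Sum.inl k)) k
    | some (Sum.inr (Sum.inr p)) => Sum.inr (Sum.inr p)
  left_inv := by
    rintro (⟨k, e⟩ | k | p)
    · cases k using Fin.cases
      · fin_cases e <;> rfl
      · rfl
    · rfl
    · rfl
  right_inv := by
    rintro (_ | ⟨k, e⟩ | k | p)
    · rfl
    · rfl
    · cases k using Fin.cases <;> rfl
    · rfl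

end Brackets

/-! ### Brackets as normalized sums over all fillings -/

section Brackets

variable {n : ℕ} (η : GL (Fin n) ℂ)

/-- The number of permutations of the positions in `slotGroup a r s t`. -/
noncomputable def slotCard (a r t : ℕ) : ℂ := 2 ^ a * a.factorial * r.factorial * t.factorial

theorem slotCard_ne_zero (a r t : ℕ) : slotCard a r t ≠ 0 := by
  simp [slotCard, Nat.factorial_ne_zero]

/-- The sum of the monomials `(η^a x^r γ^s ∂^t)^{i_α}` over all fillings `α`. -/
noncomputable def fillingSum {m : ℕ} (i : Fin m → Fin n) (a r s t : ℕ) : WC η :=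
  ∑ α : Slots a r s t ≃ Fin m, monomial η i α

/-- The group acts freely, as $\alpha$ is injective, and its elements are parametrized bijectively
by their components; so every class has the order of the group. -/
theorem card_filling_class {a r s t m : ℕ} (α : Slots a r s t ≃ Fin m)
    [DecidablePred fun β : Slots a r s t ≃ Fin m => (fillingSetoid a r s t m).r α β] :
    (Finset.univ.filter fun β => (fillingSetoid a r s t m).r α β).card
      = 2 ^ a * a.factorial * r.factorial * t.factorial := by
  have h : (Finset.univ : Finset ((Fin a → Equiv.Perm (Fin 2)) × Equiv.Perm (Fin a)
      × Equiv.Perm (Fin r) × Equiv.Perm (Fin t))).card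
      = 2 ^ a * a.factorial * r.factorial * t.factorial := by
    simp [Fintype.card_perm, mul_assoc]
  rw [← h]
  symm
  refine Finset.card_bij (fun p _ => (slotPerm p.1 p.2.1 p.2.2.1 p.2.2.2).trans α) ?_ ?_ ?_
  · rintro ⟨τ, σa, σr, σt⟩ _
    simp only [Finset.mem_filter, Finset.mem_univ, true_and]
    exact ⟨_, ⟨τ, σa, σr, σt, rfl⟩, rfl⟩
  · rintro ⟨τ, σa, σr, σt⟩ _ ⟨τ', σa', σr', σt'⟩ _ h
    have h1 : ∀ u : Slots a r s t, slotPerm τ σa σr σt u = slotPerm τ' σa' σr' σt' u := fun u =>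
      α.injective (congrArg (fun β : Slots a r s t ≃ Fin m => β u) h)
    have hη : ∀ k e, σa k = σa' k ∧ τ k e = τ' k e := fun k e =>
      Prod.ext_iff.mp (Sum.inl.inj (h1 (Sum.inl (k, e))))
    have e1 : τ = τ' := funext fun k => Equiv.ext fun e => (hη k e).2
    have e2 : σa = σa' := Equiv.ext fun k => (hη k 0).1
    have e3 : σr = σr' := Equiv.ext fun k =>
      Sum.inl.inj (Sum.inr.inj (h1 (Sum.inr (Sum.inl k))))
    have e4 : σt = σt' := Equiv.ext fun k =>
      Sum.inr.inj (Sum.inr.inj (Sum.inr.inj (h1 (Sum.inr (Sum.inr (Sum.inr k))))))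
    rw [e1, e2, e3, e4]
  · intro β hβ
    simp only [Finset.mem_filter, Finset.mem_univ, true_and] at hβ
    obtain ⟨_, ⟨τ, σa, σr, σt, rfl⟩, rfl⟩ := hβ
    exact ⟨(τ, σa, σr, σt), Finset.mem_univ _, rfl⟩

/-- Positions are easier to remove from individual fillings than from classes. Since the scalars are
complex, bracket identities can be proved after multiplying by the class size. -/
theorem slotCard_smul_bracket {m : ℕ} (i : Fin m → Fin n) (a r s t : ℕ) :
    slotCard a r t • bracket η i a (r : ℤ) s t = fillingSum η i a r s t := by
  classical
  have hb : bracket η i a (r : ℤ) s t = ∑ c : Quotient (fillingSetoid a r s t m),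
      Quotient.lift (monomial η i) (monomial_congr η i) c := by
    rw [bracket, if_pos (Int.natCast_nonneg r)]
    rfl
  rw [hb, fillingSum, Finset.smul_sum,
    ← Finset.sum_fiberwise Finset.univ
      (fun α : Slots a r s t ≃ Fin m => Quotient.mk (fillingSetoid a r s t m) α)]
  refine Finset.sum_congr (by congr) fun c _ => ?_
  induction c using Quotient.inductionOn with
  | _ α =>
    have h : ∀ β, Quotient.mk (fillingSetoid a r s t m) β = Quotient.mk _ α
        ↔ (fillingSetoid a r s t m).r α β := fun β =>
      ⟨fun h => Quotient.exact h.symm, fun h => (Quotient.sound h).symm⟩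
    simp only [h]
    rw [Finset.sum_congr rfl (g := fun _ => monomial η i α) (fun β hβ =>
      (monomial_congr η i α β (Finset.mem_filter.mp hβ).2).symm), Finset.sum_const,
      card_filling_class, Quotient.lift_mk, ← Nat.cast_smul_eq_nsmul ℂ]
    push_cast
    rfl

theorem bracket_of_neg {m : ℕ} (i : Fin m → Fin n) (a : ℕ) {r : ℤ} (hr : r < 0) (s t : ℕ) :
    bracket η i a r s t = 0 := if_neg (not_le.mpr hr)

/-! ### Monomials with one position removed -/

/-- The monomial of a filling, without its first `x`. -/
noncomputable def monomialTail {a r s t m : ℕ} (i : Fin m → Fin n)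
    (α : Slots a (r + 1) s t ≃ Fin m) : WC η :=
  (∏ k : Fin a, η.val (i (α (Sum.inl (k, 0)))) (i (α (Sum.inl (k, 1))))) •
    ((List.ofFn fun k : Fin r => x η (i (α (Sum.inr (Sum.inl k.succ))))).prod
      * (List.ofFn fun k : Fin s => g η (i (α (Sum.inr (Sum.inr (Sum.inl k)))))).prod
      * (List.ofFn fun k : Fin t => dUp η (i (α (Sum.inr (Sum.inr (Sum.inr k)))))).prod)

theorem monomial_xSlot {a r s t m : ℕ} (i : Fin (m + 1) → Fin n) (β : Slots a r s t ≃ Fin m) :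
    monomial η i (extendFilling (xSlotEquiv a r s t) β)
      = x η (i 0) * monomial η (fun k => i k.succ) β := by
  have h0 : extendFilling (xSlotEquiv a r s t) β (Sum.inr (Sum.inl 0)) = 0 :=
    extendFilling_none _ _ rfl
  have h1 : ∀ p, extendFilling (xSlotEquiv a r s t) β (Sum.inl p) = (β (Sum.inl p)).succ :=
    fun p => extendFilling_some _ _ rfl
  have h2 : ∀ k : Fin r, extendFilling (xSlotEquiv a r s t) β (Sum.inr (Sum.inl k.succ))
      = (β (Sum.inr (Sum.inl k))).succ := fun p => extendFilling_some _ _ rfl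
  have h3 : ∀ p, extendFilling (xSlotEquiv a r s t) β (Sum.inr (Sum.inr p))
      = (β (Sum.inr (Sum.inr p))).succ := fun p => extendFilling_some _ _ rfl
  simp only [monomial, List.ofFn_succ, List.prod_cons, h0, h1, h2, h3, mul_smul_comm, mul_assoc]

theorem commute_prod_ofFn {k : ℕ} (y : WC η) (f : Fin k → WC η) (h : ∀ j, Commute y (f j)) :
    Commute y (List.ofFn f).prod :=
  Commute.list_prod_right _ _ fun a ha => by
    obtain ⟨j, rfl⟩ := (List.mem_ofFn' f a).mp ha
    exact h j

theorem monomial_gSlot {a r t m : ℕ} (i : Fin (m + 1) → Fin n) (β : Slots a r 0 t ≃ Fin m) :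
    monomial η i (extendFilling (gSlotEquiv a r t) β)
      = g η (i 0) * monomial η (fun k => i k.succ) β := by
  have h0 : extendFilling (gSlotEquiv a r t) β (Sum.inr (Sum.inr (Sum.inl 0))) = 0 :=
    extendFilling_none _ _ rfl
  have h1 : ∀ p, extendFilling (gSlotEquiv a r t) β (Sum.inl p) = (β (Sum.inl p)).succ :=
    fun p => extendFilling_some _ _ rfl
  have h2 : ∀ k : Fin r, extendFilling (gSlotEquiv a r t) β (Sum.inr (Sum.inl k))
      = (β (Sum.inr (Sum.inl k))).succ := fun p => extendFilling_some _ _ rfl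
  have h3 : ∀ k : Fin t, extendFilling (gSlotEquiv a r t) β (Sum.inr (Sum.inr (Sum.inr k)))
      = (β (Sum.inr (Sum.inr (Sum.inr k)))).succ := fun p => extendFilling_some _ _ rfl
  have hc := commute_prod_ofFn η (g η (i 0))
    (fun k : Fin r => x η (i (β (Sum.inr (Sum.inl k))).succ)) fun _ => g_mul_x η _ _
  simp only [monomial, List.ofFn_succ, List.ofFn_zero, List.prod_cons, List.prod_nil, h0, h1, h2,
    h3, mul_smul_comm, mul_one, ← mul_assoc, hc.eq]

/-- The split-off $\partial$ goes to the right end, through the other $\partial$'s; on the left it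
would meet the $x$'s. -/
theorem monomial_dSlot {a r s t m : ℕ} (i : Fin (m + 1) → Fin n) (β : Slots a r s t ≃ Fin m) :
    monomial η i (extendFilling (dSlotEquiv a r s t) β)
      = monomial η (fun k => i k.succ) β * dUp η (i 0) := by
  have h0 : extendFilling (dSlotEquiv a r s t) β (Sum.inr (Sum.inr (Sum.inr 0))) = 0 :=
    extendFilling_none _ _ rfl
  have h1 : ∀ p, extendFilling (dSlotEquiv a r s t) β (Sum.inl p) = (β (Sum.inl p)).succ :=
    fun p => extendFilling_some _ _ rfl
  have h2 : ∀ k : Fin r, extendFilling (dSlotEquiv a r s t) β (Sum.inr (Sum.inl k))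
      = (β (Sum.inr (Sum.inl k))).succ := fun p => extendFilling_some _ _ rfl
  have h3 : ∀ k : Fin s, extendFilling (dSlotEquiv a r s t) β (Sum.inr (Sum.inr (Sum.inl k)))
      = (β (Sum.inr (Sum.inr (Sum.inl k)))).succ := fun p => extendFilling_some _ _ rfl
  have h4 : ∀ k : Fin t, extendFilling (dSlotEquiv a r s t) β
      (Sum.inr (Sum.inr (Sum.inr k.succ))) = (β (Sum.inr (Sum.inr (Sum.inr k)))).succ :=
    fun p => extendFilling_some _ _ rfl
  have hc := commute_prod_ofFn η (dUp η (i 0))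
    (fun k : Fin t => dUp η (i (β (Sum.inr (Sum.inr (Sum.inr k)))).succ)) fun _ => dUp_mul_dUp η _ _
  simp only [monomial, List.ofFn_succ, List.prod_cons, h0, h1, h2, h3, h4, smul_mul_assoc, hc.eq]
  simp only [mul_assoc]

/-- The partner of the index $0$ is treated as an extra $x$ contracted with $\partial^{i_0}$. The
same expression arises from the commutator in `dUp_mul_fillingSum`. -/
theorem monomial_etaSlot {a r s t m : ℕ} (i : Fin (m + 1) → Fin n)
    (β : Slots a (r + 1) s t ≃ Fin m) :
    monomial η i (extendFilling (etaSlotEquiv a r s t) β)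
      = η.val (i 0) (i (β (Sum.inr (Sum.inl 0))).succ)
        • monomialTail η (fun k => i k.succ) β := by
  have h0 : extendFilling (etaSlotEquiv a r s t) β (Sum.inl (0, 0)) = 0 :=
    extendFilling_none _ _ rfl
  have h0' : extendFilling (etaSlotEquiv a r s t) β (Sum.inl (0, 1))
      = (β (Sum.inr (Sum.inl 0))).succ := extendFilling_some _ _ rfl
  have h1 : ∀ k e, extendFilling (etaSlotEquiv a r s t) β (Sum.inl (Fin.succ k, e))
      = (β (Sum.inl (k, e))).succ := fun k e => extendFilling_some _ _ rfl
  have h2 : ∀ k : Fin r, extendFilling (etaSlotEquiv a r s t) β (Sum.inr (Sum.inl k))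
      = (β (Sum.inr (Sum.inl k.succ))).succ := fun p => extendFilling_some _ _ rfl
  have h3 : ∀ p, extendFilling (etaSlotEquiv a r s t) β (Sum.inr (Sum.inr p))
      = (β (Sum.inr (Sum.inr p))).succ := fun p => extendFilling_some _ _ rfl
  simp only [monomial, monomialTail, Fin.prod_univ_succ (n := a), h0, h0', h1, h2, h3, mul_smul]

/-! ### Commutators with `∂^i` -/

theorem dUp_mul_prod_x (j : Fin n) {r : ℕ} (f : Fin (r + 1) → Fin n) :
    dUp η j * (List.ofFn fun k => x η (f k)).prod
      = (List.ofFn fun k => x η (f k)).prod * dUp η j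
        + ∑ k, η.val j (f k) • (List.ofFn fun l => x η (f (k.succAbove l))).prod := by
  induction r with
  | zero => simp [dUp_mul_x, Algebra.algebraMap_eq_smul_one]
  | succ r ih =>
    rw [List.ofFn_succ, List.prod_cons, ← mul_assoc, dUp_mul_x, add_mul, mul_assoc,
      ← Algebra.smul_def, ih fun k => f k.succ, mul_add, Fin.sum_univ_succ (n := r + 1), Finset.mul_sum]
    simp only [Fin.succAbove_zero, List.ofFn_succ (n := r), List.prod_cons, Fin.succ_succAbove_zero,
      Fin.succ_succAbove_succ, mul_smul_comm, mul_assoc]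
    abel

theorem dUp_mul_monomial_zero (j : Fin n) {a s t m : ℕ} (i : Fin m → Fin n)
    (α : Slots a 0 s t ≃ Fin m) : dUp η j * monomial η i α = monomial η i α * dUp η j := by
  have hg := commute_prod_ofFn η (dUp η j)
    (fun k : Fin s => g η (i (α (Sum.inr (Sum.inr (Sum.inl k)))))) fun _ => (g_mul_dUp η _ _).symm
  have hd := commute_prod_ofFn η (dUp η j)
    (fun k : Fin t => dUp η (i (α (Sum.inr (Sum.inr (Sum.inr k)))))) fun _ => dUp_mul_dUp η _ _
  rw [monomial, mul_smul_comm, smul_mul_assoc, List.ofFn_zero, List.prod_nil, one_mul,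
    (hg.mul_right hd).eq]

/-- This is the Leibniz rule. The cycle `k.cycleRange.symm` puts the $k$-th $x$ first and keeps the
order of the others, so every contraction becomes one function of a permuted filling and all of them
agree after summing over fillings. -/
theorem dUp_mul_monomial (j : Fin n) {a r s t m : ℕ} (i : Fin m → Fin n)
    (α : Slots a (r + 1) s t ≃ Fin m) :
    dUp η j * monomial η i α = monomial η i α * dUp η j
      + ∑ k : Fin (r + 1), (fun β : Slots a (r + 1) s t ≃ Fin m =>
          η.val j (i (β (Sum.inr (Sum.inl 0)))) • monomialTail η i β)
        ((slotPerm 1 1 k.cycleRange.symm 1).trans α) := by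
  have hg := commute_prod_ofFn η (dUp η j)
    (fun k : Fin s => g η (i (α (Sum.inr (Sum.inr (Sum.inl k)))))) fun _ => (g_mul_dUp η _ _).symm
  have hd := commute_prod_ofFn η (dUp η j)
    (fun k : Fin t => dUp η (i (α (Sum.inr (Sum.inr (Sum.inr k)))))) fun _ => dUp_mul_dUp η _ _
  have h1 : ∀ (k : Fin (r + 1)) p,
      (slotPerm 1 1 k.cycleRange.symm 1).trans α (Sum.inl p) = α (Sum.inl p) := fun _ _ => rfl
  have h2 : ∀ (k : Fin (r + 1)) l, (slotPerm 1 1 k.cycleRange.symm 1).trans α (Sum.inr (Sum.inl l))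
      = α (Sum.inr (Sum.inl (k.cycleRange.symm l))) := fun _ _ => rfl
  have h3 : ∀ (k : Fin (r + 1)) l,
      (slotPerm 1 1 k.cycleRange.symm 1).trans α (Sum.inr (Sum.inr (Sum.inl l)))
      = α (Sum.inr (Sum.inr (Sum.inl l))) := fun _ _ => rfl
  have h4 : ∀ (k : Fin (r + 1)) l,
      (slotPerm 1 1 k.cycleRange.symm 1).trans α (Sum.inr (Sum.inr (Sum.inr l)))
      = α (Sum.inr (Sum.inr (Sum.inr l))) := fun _ _ => rfl
  have hx := dUp_mul_prod_x η j fun k : Fin (r + 1) => i (α (Sum.inr (Sum.inl k)))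
  simp only [monomialTail, h1, h2, h3, h4, Fin.cycleRange_symm_zero, Fin.cycleRange_symm_succ]
  rw [monomial, mul_smul_comm, smul_mul_assoc, mul_assoc _ _ (List.prod _), ← mul_assoc, hx,
    add_mul, mul_assoc, (hg.mul_right hd).eq, ← mul_assoc, smul_add, Finset.sum_mul,
    Finset.smul_sum]
  congr 1
  refine Finset.sum_congr rfl fun k _ => ?_
  rw [smul_mul_assoc, smul_comm, mul_assoc]

/-! ### The recursion for the brackets -/

theorem sum_trans_filling {S T M : Type*} [Fintype S] [DecidableEq S] [Fintype T] [DecidableEq T]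
    [AddCommMonoid M] (σ : Equiv.Perm S) (f : (S ≃ T) → M) : ∑ α, f (σ.trans α) = ∑ α, f α :=
  Fintype.sum_equiv ⟨fun α => σ.trans α, fun α => σ.symm.trans α,
    fun α => by ext; simp, fun α => by ext; simp⟩ _ _ fun _ => rfl

/-- Monomials are constant on orbits, so positions exchanged by the group contribute equally; it
suffices to treat the first position of each kind. -/
theorem sum_monomial_slotPerm {a r s t m : ℕ} (i : Fin (m + 1) → Fin n)
    {p : Equiv.Perm (Slots a r s t)} (hp : p ∈ slotGroup a r s t) {u v : Slots a r s t}
    (huv : p u = v) :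
    ∑ α : Slots a r s t ≃ Fin (m + 1) with α v = 0, monomial η i α
      = ∑ α : Slots a r s t ≃ Fin (m + 1) with α u = 0, monomial η i α := by
  rw [Finset.sum_filter, Finset.sum_filter, ← sum_trans_filling p fun α : Slots a r s t ≃ Fin (m + 1) =>
    if α u = 0 then monomial η i α else 0]
  refine Finset.sum_congr rfl fun α _ => ?_
  rw [monomial_congr η i α (p.trans α) ⟨p, hp, rfl⟩, Equiv.trans_apply, huv]

theorem sum_monomial_x {m : ℕ} (i : Fin (m + 1) → Fin n) (a r s t : ℕ) :
    ∑ k : Fin r, ∑ α : Slots a r s t ≃ Fin (m + 1) with α (Sum.inr (Sum.inl k)) = 0,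
        monomial η i α
      = slotCard a r t • (x η (i 0) * bracket η (fun k => i k.succ) a ((r : ℤ) - 1) s t) := by
  cases r with
  | zero => rw [bracket_of_neg η _ _ (by simp)]; simp
  | succ r =>
    have h : ∀ k : Fin (r + 1), ∑ α : Slots a (r + 1) s t ≃ Fin (m + 1) with
        α (Sum.inr (Sum.inl k)) = 0, monomial η i α
        = x η (i 0) * fillingSum η (fun k => i k.succ) a r s t := by
      intro k
      rw [sum_monomial_slotPerm η i (u := Sum.inr (Sum.inl 0)) (v := Sum.inr (Sum.inl k))
        ⟨1, 1, Equiv.swap 0 k, 1, rfl⟩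
        (congrArg (fun l => Sum.inr (Sum.inl l)) (Equiv.swap_apply_left 0 k)),
        sum_filling_zero (xSlotEquiv a r s t) rfl, fillingSum, Finset.mul_sum]
      simp only [monomial_xSlot]
    rw [Finset.sum_congr rfl fun k _ => h k, Finset.sum_const, Finset.card_univ, Fintype.card_fin,
      ← slotCard_smul_bracket, mul_smul_comm, ← Nat.cast_smul_eq_nsmul ℂ, smul_smul, Nat.cast_succ,
      show ((r + 1 : ℕ) : ℤ) - 1 = r by simp]
    congr 1
    simp only [slotCard, Nat.factorial_succ]
    push_cast; ring

theorem sum_monomial_d {m : ℕ} (i : Fin (m + 1) → Fin n) (a r s t : ℕ) :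
    ∑ k : Fin t, ∑ α : Slots a r s t ≃ Fin (m + 1) with α (Sum.inr (Sum.inr (Sum.inr k))) = 0,
        monomial η i α
      = slotCard a r t • if t = 0 then 0 else
        bracket η (fun k => i k.succ) a (r : ℤ) s (t - 1) * dUp η (i 0) := by
  cases t with
  | zero => simp
  | succ t =>
    have h : ∀ k : Fin (t + 1), ∑ α : Slots a r s (t + 1) ≃ Fin (m + 1) with
        α (Sum.inr (Sum.inr (Sum.inr k))) = 0, monomial η i α
        = fillingSum η (fun k => i k.succ) a r s t * dUp η (i 0) := by
      intro k
      rw [sum_monomial_slotPerm η i (u := Sum.inr (Sum.inr (Sum.inr 0)))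
        (v := Sum.inr (Sum.inr (Sum.inr k))) ⟨1, 1, 1, Equiv.swap 0 k, rfl⟩
        (congrArg (fun l => Sum.inr (Sum.inr (Sum.inr l))) (Equiv.swap_apply_left 0 k)),
        sum_filling_zero (dSlotEquiv a r s t) rfl, fillingSum, Finset.sum_mul]
      simp only [monomial_dSlot]
    rw [Finset.sum_congr rfl fun k _ => h k, Finset.sum_const, Finset.card_univ, Fintype.card_fin,
      ← slotCard_smul_bracket, smul_mul_assoc, ← Nat.cast_smul_eq_nsmul ℂ, smul_smul,
      if_neg (Nat.succ_ne_zero t), Nat.add_sub_cancel]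
    congr 1
    simp only [slotCard, Nat.factorial_succ]
    push_cast; ring

theorem dUp_mul_fillingSum {m : ℕ} (i : Fin m → Fin n) (j : Fin n) (a r s t : ℕ) :
    dUp η j * fillingSum η i a (r + 1) s t - fillingSum η i a (r + 1) s t * dUp η j
      = (r + 1 : ℂ) • ∑ β : Slots a (r + 1) s t ≃ Fin m,
        η.val j (i (β (Sum.inr (Sum.inl 0)))) • monomialTail η i β := by
  rw [sub_eq_iff_eq_add', fillingSum, Finset.mul_sum, Finset.sum_mul]
  simp only [dUp_mul_monomial, Finset.sum_add_distrib]
  rw [Finset.sum_comm]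
  congr 1
  refine (Finset.sum_congr rfl fun k _ => sum_trans_filling (slotPerm 1 1 k.cycleRange.symm 1)
    fun β : Slots a (r + 1) s t ≃ Fin m =>
      η.val j (i (β (Sum.inr (Sum.inl 0)))) • monomialTail η i β).trans ?_
  rw [Finset.sum_const, Finset.card_univ,
    Fintype.card_fin, ← Nat.cast_smul_eq_nsmul ℂ, Nat.cast_succ]

theorem dUp_mul_bracket_zero {m : ℕ} (i : Fin m → Fin n) (j : Fin n) (a s t : ℕ) :
    dUp η j * bracket η i a 0 s t = bracket η i a 0 s t * dUp η j := by
  refine smul_right_injective (WC η) (slotCard_ne_zero a 0 t) ?_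
  have h := slotCard_smul_bracket η i a 0 s t
  rw [Nat.cast_zero] at h
  dsimp only
  rw [← mul_smul_comm, ← smul_mul_assoc, h, fillingSum, Finset.mul_sum, Finset.sum_mul]
  exact Finset.sum_congr rfl fun α _ => dUp_mul_monomial_zero η j i α

/-- Each of the $2a$ positions gives the same sum of contractions, and the commutator of
$\partial^{i_0}$ with a sum over fillings having $r+1$ letters $x$ is $r+1$ times it. -/
theorem sum_monomial_eta {m : ℕ} (i : Fin (m + 1) → Fin n) (a r s t : ℕ) :
    ∑ p : Fin a × Fin 2, ∑ α : Slots a r s t ≃ Fin (m + 1) with α (Sum.inl p) = 0,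
        monomial η i α
      = slotCard a r t • if a = 0 then 0 else
        dUp η (i 0) * bracket η (fun k => i k.succ) (a - 1) ((r : ℤ) + 1) s t
          - bracket η (fun k => i k.succ) (a - 1) ((r : ℤ) + 1) s t * dUp η (i 0) := by
  cases a with
  | zero => simp
  | succ a =>
    have h : ∀ p : Fin (a + 1) × Fin 2, ∑ α : Slots (a + 1) r s t ≃ Fin (m + 1) with
        α (Sum.inl p) = 0, monomial η i α
        = ∑ β : Slots a (r + 1) s t ≃ Fin m,
          η.val (i 0) (i (β (Sum.inr (Sum.inl 0))).succ)
            • monomialTail η (fun k => i k.succ) β := by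
      rintro ⟨k, e⟩
      rw [sum_monomial_slotPerm η i (u := Sum.inl (0, 0)) (v := Sum.inl (k, e))
        ⟨fun _ => Equiv.swap 0 e, Equiv.swap 0 k, 1, 1, rfl⟩
        (congrArg Sum.inl (Prod.ext (Equiv.swap_apply_left 0 k) (Equiv.swap_apply_left 0 e))),
        sum_filling_zero (etaSlotEquiv a r s t) rfl]
      simp only [monomial_etaSlot]
    have hd := dUp_mul_fillingSum η (fun k => i k.succ) (i 0) a r s t
    rw [← slotCard_smul_bracket, mul_smul_comm, smul_mul_assoc, ← smul_sub, Nat.cast_succ] at hd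
    rw [Finset.sum_congr rfl fun p _ => h p, Finset.sum_const, Finset.card_univ,
      Fintype.card_prod, Fintype.card_fin, Fintype.card_fin, ← Nat.cast_smul_eq_nsmul ℂ,
      if_neg (Nat.succ_ne_zero a), Nat.add_sub_cancel]
    -- After multiplying by $r+1$ the constants match, because `slotCard (a + 1) r t` times $r+1$ is
    -- $2(a+1)$ times `slotCard a (r + 1) t`.
    have hr : (r + 1 : ℂ) ≠ 0 := by exact_mod_cast Nat.succ_ne_zero r
    refine smul_right_injective (WC η) hr ?_
    dsimp only
    rw [smul_comm, ← hd, smul_smul, smul_smul]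
    congr 1
    simp only [slotCard, Nat.factorial_succ, pow_succ]
    push_cast; ring

theorem sum_monomial_g {m : ℕ} (i : Fin (m + 1) → Fin n) (a r t : ℕ) {s : ℕ} (hs : s ≤ 1) :
    ∑ k : Fin s, ∑ α : Slots a r s t ≃ Fin (m + 1) with α (Sum.inr (Sum.inr (Sum.inl k))) = 0,
        monomial η i α
      = slotCard a r t • if s = 0 then 0 else
        g η (i 0) * bracket η (fun k => i k.succ) a (r : ℤ) 0 t := by
  rcases Nat.le_one_iff_eq_zero_or_eq_one.mp hs with rfl | rfl
  · simp
  · rw [Fin.sum_univ_one, sum_filling_zero (gSlotEquiv a r t) rfl, if_neg one_ne_zero,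
      ← mul_smul_comm, slotCard_smul_bracket, fillingSum, Finset.mul_sum]
    simp only [monomial_gSlot]

/-- The terms record whether the first index sits on an $x$, a $\partial$, an $\eta$ or the
$\gamma$. With at most one $\gamma$ no reordering of Clifford generators is needed. -/
theorem bracket_succ {m : ℕ} (i : Fin (m + 1) → Fin n) (a : ℕ) (r : ℤ) {s : ℕ} (hs : s ≤ 1)
    (t : ℕ) :
    bracket η i a r s t = x η (i 0) * bracket η (fun k => i k.succ) a (r - 1) s t
      + (if t = 0 then 0 else bracket η (fun k => i k.succ) a r s (t - 1) * dUp η (i 0))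
      + (if a = 0 then 0 else
        dUp η (i 0) * bracket η (fun k => i k.succ) (a - 1) (r + 1) s t
          - bracket η (fun k => i k.succ) (a - 1) (r + 1) s t * dUp η (i 0))
      + (if s = 0 then 0 else g η (i 0) * bracket η (fun k => i k.succ) a r 0 t) := by
  rcases lt_or_ge r 0 with hr | hr
  · have h : dUp η (i 0) * bracket η (fun k => i k.succ) (a - 1) (r + 1) s t
        - bracket η (fun k => i k.succ) (a - 1) (r + 1) s t * dUp η (i 0) = 0 := by
      -- At $r=-1$ the shorter bracket need not vanish, but it contains no $x$ and so commutes with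
      -- $\partial^{i_0}$.
      rcases (show r + 1 ≤ 0 from hr).lt_or_eq with h | h
      · rw [bracket_of_neg η _ _ h, mul_zero, zero_mul, sub_zero]
      · rw [h, dUp_mul_bracket_zero, sub_self]
    rw [h, bracket_of_neg η i _ hr, bracket_of_neg η _ a (show r - 1 < 0 by omega),
      bracket_of_neg η _ a hr, bracket_of_neg η _ a hr]
    simp
  · obtain ⟨r, rfl⟩ := Int.eq_ofNat_of_zero_le hr
    refine smul_right_injective (WC η) (slotCard_ne_zero a r t) ?_
    dsimp only
    rw [slotCard_smul_bracket, smul_add, smul_add, smul_add, ← sum_monomial_x, ← sum_monomial_d,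
      ← sum_monomial_eta, ← sum_monomial_g η i a r t hs, fillingSum, sum_filling,
      Fintype.sum_sum_type, Fintype.sum_sum_type, Fintype.sum_sum_type]
    abel

theorem bracket_zero_zero (i : Fin 0 → Fin n) : bracket η i 0 0 0 0 = 1 := by
  have h := slotCard_smul_bracket η i 0 0 0 0
  have h1 : slotCard 0 0 0 = 1 := by simp [slotCard]
  have h2 : ∀ α, monomial η i (α : Slots 0 0 0 0 ≃ Fin 0) = 1 := fun α => by simp [monomial]
  rw [h1, one_smul, Nat.cast_zero] at h
  rw [h, fillingSum, Finset.sum_congr rfl fun α _ => h2 α, Finset.sum_const, Finset.card_univ,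
    Fintype.card_equiv (Equiv.equivOfIsEmpty _ _)]
  simp

/-! ### The recursions for `S_q^0` and `S_q^1` -/

/-- `∑_{t=0}^q [η^t x^{c-t} γ^s ∂^{q-t}]`. -/
noncomputable def bracketSum {m : ℕ} (i : Fin m → Fin n) (s : ℕ) (c : ℤ) (q : ℕ) : WC η :=
  ∑ t ∈ Finset.range (q + 1), bracket η i t (c - t) s (q - t)

theorem S0_eq {m : ℕ} (i : Fin m → Fin n) (q : ℕ) :
    S0 η i q = bracketSum η i 0 ((m : ℤ) - q) q := rfl

theorem S1_zero {m : ℕ} (i : Fin m → Fin n) : S1 η i 0 = 0 := rfl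

theorem S1_succ {m : ℕ} (i : Fin m → Fin n) (q : ℕ) :
    S1 η i (q + 1) = bracketSum η i 1 ((m : ℤ) - (q + 1 : ℕ)) q := rfl

theorem bracketSum_zero {m : ℕ} (i : Fin (m + 1) → Fin n) {s : ℕ} (hs : s ≤ 1) (c : ℤ) :
    bracketSum η i s c 0 = x η (i 0) * bracketSum η (fun k => i k.succ) s (c - 1) 0
      + (if s = 0 then 0 else g η (i 0) * bracketSum η (fun k => i k.succ) 0 c 0) := by
  simp [bracketSum, bracket_succ η i _ _ hs]

/-- For a shorter bracket $B_t$ with $t$ factors $\eta$, the $\partial$-positions of the summand $t$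
give $B_t\partial$ and the $\eta$-positions of the summand $t+1$ give $\partial B_t-B_t\partial$.
They add up to $\partial B_t$, which is why the sum over $t$ has a simpler recursion than its terms.
-/
theorem bracketSum_succ {m : ℕ} (i : Fin (m + 1) → Fin n) {s : ℕ} (hs : s ≤ 1) (c : ℤ) (q : ℕ) :
    bracketSum η i s c (q + 1) = x η (i 0) * bracketSum η (fun k => i k.succ) s (c - 1) (q + 1)
      + dUp η (i 0) * bracketSum η (fun k => i k.succ) s c q
      + (if s = 0 then 0 else g η (i 0) * bracketSum η (fun k => i k.succ) 0 c (q + 1)) := by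
  have hd : ∑ t ∈ Finset.range (q + 2), (if q + 1 - t = 0 then 0 else
      bracket η (fun k => i k.succ) t (c - t) s (q + 1 - t - 1) * dUp η (i 0))
      = bracketSum η (fun k => i k.succ) s c q * dUp η (i 0) := by
    rw [Finset.sum_range_succ, Nat.sub_self, if_pos rfl, add_zero, bracketSum, Finset.sum_mul]
    refine Finset.sum_congr rfl fun t ht => ?_
    rw [Finset.mem_range] at ht
    rw [if_neg (by omega), show q + 1 - t - 1 = q - t by omega]
  have he : ∑ t ∈ Finset.range (q + 2), (if t = 0 then 0 else
      dUp η (i 0) * bracket η (fun k => i k.succ) (t - 1) (c - t + 1) s (q + 1 - t)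
        - bracket η (fun k => i k.succ) (t - 1) (c - t + 1) s (q + 1 - t) * dUp η (i 0))
      = dUp η (i 0) * bracketSum η (fun k => i k.succ) s c q
        - bracketSum η (fun k => i k.succ) s c q * dUp η (i 0) := by
    rw [Finset.sum_range_succ', if_pos rfl, add_zero, bracketSum, Finset.mul_sum, Finset.sum_mul,
      ← Finset.sum_sub_distrib]
    refine Finset.sum_congr rfl fun t _ => ?_
    rw [if_neg (Nat.succ_ne_zero t), Nat.add_sub_cancel, Nat.add_sub_add_right,
      show c - ((t + 1 : ℕ) : ℤ) + 1 = c - t by push_cast; ring]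
  have hg : ∑ t ∈ Finset.range (q + 2), (if s = 0 then 0 else
      g η (i 0) * bracket η (fun k => i k.succ) t (c - t) 0 (q + 1 - t))
      = if s = 0 then 0 else g η (i 0) * bracketSum η (fun k => i k.succ) 0 c (q + 1) := by
    split_ifs
    · exact Finset.sum_const_zero
    · rw [bracketSum, Finset.mul_sum]
  have hx : ∑ t ∈ Finset.range (q + 2),
      x η (i 0) * bracket η (fun k => i k.succ) t (c - t - 1) s (q + 1 - t)
      = x η (i 0) * bracketSum η (fun k => i k.succ) s (c - 1) (q + 1) := by
    rw [bracketSum, Finset.mul_sum]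
    refine Finset.sum_congr rfl fun t _ => ?_
    rw [sub_right_comm]
  rw [bracketSum, Finset.sum_congr rfl fun t _ => bracket_succ η i t (c - t) hs (q + 1 - t),
    Finset.sum_add_distrib, Finset.sum_add_distrib, Finset.sum_add_distrib, hd, he, hg, hx]
  abel

theorem S0_succ_zero {m : ℕ} (i : Fin (m + 1) → Fin n) :
    S0 η i 0 = x η (i 0) * S0 η (fun k => i k.succ) 0 := by
  rw [S0_eq, S0_eq, bracketSum_zero η i zero_le_one, if_pos rfl, add_zero]
  congr 2
  push_cast; ring

theorem S0_succ_succ {m : ℕ} (i : Fin (m + 1) → Fin n) (q : ℕ) :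
    S0 η i (q + 1) = x η (i 0) * S0 η (fun k => i k.succ) (q + 1)
      + dUp η (i 0) * S0 η (fun k => i k.succ) q := by
  rw [S0_eq, S0_eq, S0_eq, bracketSum_succ η i zero_le_one, if_pos rfl, add_zero]
  congr 3
  · push_cast; ring
  · push_cast; ring

theorem S1_succ_succ {m : ℕ} (i : Fin (m + 1) → Fin n) (q : ℕ) :
    S1 η i (q + 1) = x η (i 0) * S1 η (fun k => i k.succ) (q + 1)
      + dUp η (i 0) * S1 η (fun k => i k.succ) q
      + g η (i 0) * S0 η (fun k => i k.succ) q := by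
  have h : ∀ q : ℕ, ((m + 1 : ℕ) : ℤ) - (q + 1 : ℕ) = (m : ℤ) - q := fun q => by push_cast; ring
  have h' : ∀ q : ℕ, (m : ℤ) - q - 1 = m - (q + 1 : ℕ) := fun q => by push_cast; ring
  rw [S1_succ, S1_succ, S0_eq, h, ← h']
  cases q with
  | zero => rw [bracketSum_zero η i le_rfl, if_neg one_ne_zero, S1_zero, mul_zero, add_zero]
  | succ q => rw [bracketSum_succ η i le_rfl, if_neg one_ne_zero, S1_succ]

theorem S0_empty_zero (i : Fin 0 → Fin n) : S0 η i 0 = 1 := by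
  simp [S0, bracket_zero_zero]

theorem S0_eq_zero {m : ℕ} (i : Fin m → Fin n) {q : ℕ} (h : m < q) : S0 η i q = 0 := by
  refine Finset.sum_eq_zero fun t _ => bracket_of_neg η i t (by omega) 0 _

theorem S1_eq_zero {m : ℕ} (i : Fin m → Fin n) {q : ℕ} (h : m < q) : S1 η i q = 0 := by
  refine Finset.sum_eq_zero fun t _ => bracket_of_neg η i t (by omega) 1 _

theorem S0_zero {m : ℕ} (i : Fin m → Fin n) :
    S0 η i 0 = (List.ofFn fun k => x η (i k)).prod := by
  induction m with
  | zero => rw [S0_empty_zero, List.ofFn_zero, List.prod_nil]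
  | succ m ih => rw [S0_succ_zero, ih, List.ofFn_succ, List.prod_cons]

/-! ### Products of raising operators -/

/-- The part of degree `q` in the normally ordered product of raising operators, without its
coefficient. -/
noncomputable def raiseTerm {m : ℕ} (i : Fin m → Fin n) (q : ℕ) : WC η :=
  Ftilde η ^ q * S0 η i q + Ftilde η ^ (q - 1) * Ytilde η * S1 η i q

variable {η}

theorem raise_mul_raiseTerm (hs : ∀ i j, η.val i j = η.val j i) {m : ℕ} (i : Fin m → Fin n)
    (j : Fin n) (q : ℕ) :
    raise η j * raiseTerm η i q
      = (H η + ((q + 1 : ℕ) : WC η)) * (Ftilde η ^ q * (x η j * S0 η i q)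
          + Ftilde η ^ (q - 1) * Ytilde η * (x η j * S1 η i q))
        + (1 / 2 : ℂ) • (Ftilde η ^ (q + 1) * (dUp η j * S0 η i q)
          + Ftilde η ^ q * Ytilde η * (dUp η j * S1 η i q + g η j * S0 η i q)) := by
  have h1 : raise η j * (Ftilde η ^ (q - 1) * Ytilde η) * S1 η i q
      = (H η + ((q + 1 : ℕ) : WC η)) * (Ftilde η ^ (q - 1) * Ytilde η * x η j) * S1 η i q
        + (1 / 2 : ℂ) • (Ftilde η ^ q * Ytilde η * dUp η j) * S1 η i q := by
    -- At $q=0$ the truncated exponent $q-1$ is harmless because $S_0^1=0$.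
    cases q with
    | zero => simp only [S1_zero, mul_zero, add_zero]
    | succ q => rw [Nat.add_sub_cancel, raise_mul_Ftilde_pow_mul_Ytilde hs, add_mul]
  rw [raiseTerm, mul_add, ← mul_assoc, raise_mul_Ftilde_pow hs, ← mul_assoc (raise η j), h1]
  simp only [add_mul, mul_add, smul_add, smul_mul_assoc, mul_assoc]
  abel

/-- This holds in $\mathcal A$ itself, before passing to cosets. In the induction step $A_q$ keeps
the coefficient of degree $q$, whereas $B_q$ acquires that of degree $q+1$; by the recursions the
new term of degree $q+1$ is $A_{q+1}+B_q$. -/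
theorem prod_raise (hs : ∀ i j, η.val i j = η.val j i) {m : ℕ} (i : Fin m → Fin n) :
    (List.ofFn fun k => raise η (i k)).prod
      = ∑ q ∈ Finset.range (m + 1), ((1 : ℂ) / 2 ^ q) • (risingH η q m * raiseTerm η i q) := by
  induction m with
  | zero => simp [raiseTerm, risingH, S0_empty_zero, S1_zero]
  | succ m ih =>
    set i' : Fin m → Fin n := fun k => i k.succ with hi'
    -- the contributions of the factor `x` and of the factors `γ`, `∂`
    set A : ℕ → WC η := fun q => Ftilde η ^ q * (x η (i 0) * S0 η i' q)
      + Ftilde η ^ (q - 1) * Ytilde η * (x η (i 0) * S1 η i' q) with hA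
    set B : ℕ → WC η := fun q => Ftilde η ^ (q + 1) * (dUp η (i 0) * S0 η i' q)
      + Ftilde η ^ q * Ytilde η * (dUp η (i 0) * S1 η i' q + g η (i 0) * S0 η i' q) with hB
    have h0 : raiseTerm η i 0 = A 0 := by
      simp only [raiseTerm, hA, S0_succ_zero, S1_zero, mul_zero]
      rfl
    have h1 : ∀ q, raiseTerm η i (q + 1) = A (q + 1) + B q := by
      intro q
      simp only [raiseTerm, hA, hB, S0_succ_succ, S1_succ_succ, Nat.add_sub_cancel, mul_add]
      abel
    -- The sum for $m+1$ has one more $A$ than the induction hypothesis supplies; it vanishes since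
    -- its brackets have negative $x$-exponents.
    have h2 : A (m + 1) = 0 := by
      simp only [hA, S0_eq_zero η i' (Nat.lt_succ_self m), S1_eq_zero η i' (Nat.lt_succ_self m),
        mul_zero, add_zero]
    have h3 : ∀ q ∈ Finset.range (m + 1),
        raise η (i 0) * (((1 : ℂ) / 2 ^ q) • (risingH η q m * raiseTerm η i' q))
        = ((1 : ℂ) / 2 ^ q) • (risingH η q (m + 1) * A q)
          + ((1 : ℂ) / 2 ^ (q + 1)) • (risingH η (q + 1) (m + 1) * B q) := by
      intro q hq
      rw [mul_smul_comm, ← mul_assoc, raise_mul_risingH, mul_assoc, raise_mul_raiseTerm hs, mul_add,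
        ← mul_assoc (risingH η (q + 1) (m + 1)), risingH_succ_mul η (Finset.mem_range.mp hq),
        smul_add, mul_smul_comm, smul_smul, pow_succ (2 : ℂ), one_div_mul_one_div]
    rw [List.ofFn_succ, List.prod_cons, ih i', Finset.mul_sum, Finset.sum_congr rfl h3,
      Finset.sum_add_distrib, Finset.sum_range_succ' _ (m + 1), h0]
    simp only [h1, mul_add, smul_add, Finset.sum_add_distrib]
    rw [add_right_comm, ← Finset.sum_range_succ'
      (fun q => ((1 : ℂ) / 2 ^ q) • (risingH η q (m + 1) * A q)) (m + 1),
      Finset.sum_range_succ _ (m + 1), h2, mul_zero, smul_zero, add_zero]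

end Brackets

end DiracReduction

/-! ### The product formula -/

open DiracReduction in
theorem mainTheorem2 {n : ℕ} (η : GL (Fin n) ℂ) {m : ℕ} (i : Fin m → Fin n) :
    toCoset η (List.ofFn fun k => xHat η (i k)).prod =
      coset η (loc η (risingH η 0 m * (List.ofFn fun k => x η (i k)).prod +
        ∑ q ∈ Finset.Icc 1 m, ((1 : ℂ) / 2 ^ q) •
          (risingH η q m * Ftilde η ^ (q - 1) *
            (Ytilde η * S1 η i q + Ftilde η * S0 η i q)))) := by
  rw [toCoset_list_prod _ _ fun k => toCoset_xHat η (i k)]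
  -- Both sides are cosets of elements of $\mathcal A$, and these elements already agree.
  congr 2
  rcases symm_or_subsingleton η with hs | hs
  swap
  · exact Subsingleton.elim _ _
  -- The summand $q=0$ is the leading term, as $S_0^1=0$ and $S_0^0=x^{i_1}\cdots x^{i_m}$.
  rw [prod_raise hs, Finset.sum_range_succ', add_comm]
  congr 1
  · rw [pow_zero, div_one, one_smul, raiseTerm, S1_zero, mul_zero, add_zero, pow_zero, one_mul,
      S0_zero]
  · rw [Finset.range_eq_Ico, Finset.sum_Ico_add' (fun q => ((1 : ℂ) / 2 ^ q) •
      (risingH η q m * raiseTerm η i q)) 0 m 1]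
    refine Finset.sum_congr rfl fun q hq => ?_
    obtain ⟨q, rfl⟩ := Nat.exists_eq_add_of_le' (Finset.mem_Icc.mp hq).1
    rw [raiseTerm, Nat.add_sub_cancel, pow_succ (Ftilde η)]
    simp only [mul_assoc, mul_add]
    rw [add_comm (risingH η (q + 1) m * _)]
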